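/- **Theorem (Dispersion dichotomy).** Write $\log=\log_2$, let $\varepsilon,\delta\in(0,1)$ be fixed, let $\Phi$ be the standard normal distribution function, $V_{\mathrm{cache}}=\varepsilon(1-\varepsilon)(\log m)^2$ and $N^*=\lfloor \ln\frac1{1-\delta}/\ln\frac1{1-\varepsilon}\rfloor$. All $O$-constants below depend only on the parameters named as fixed. *Coded caching.* A query is a tuple $q\in[m]^\kappa$. A coded scheme with $\sigma$ bits is a pair of computable maps, $\mathrm{Enc}$ from queries to $\{0,1\}^\sigma$ and $\mathrm{Dec}$, which sees $\mathrm{Enc}(q)$ and the output of $\kappa$ independent uses of the $m$-ary erasure channel with erasure probability $\varepsilon$ on input $q$. For a family $\mathcal Q\subseteq[m]^\kappa$, $\sigma^*_{\mathrm{code}}(\mathcal Q)$ is the least $\sigma$ for which some scheme decodes every $q\in\mathcal Q$ correctly with probability at least $1-\delta$. *Derivation-constrained caching.* Fix $k\ge 2$ and one of two Datalog programs over the base $B=\{A(i):i\in[m]\}$: the chain program, with rules $T_k(x_1,\dots,x_k)\leftarrow A(x_1),\dots,A(x_k)$ and $T_{n+1}(\vec x,y)\leftarrow T_n(\vec x),A(y)$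 for $n\ge k$; or the merge program, with rules $R_1(x_1,\dots,x_k)\leftarrow A(x_1),\dots,A(x_k)$ and $R_{d+1}(\vec x,\vec y)\leftarrow R_d(\vec x),R_d(\vec y)$, $d\ge1$, where $R_d$ has arity $k2^{d-1}$. The depth-$d$ queries ($d\ge 1$) are the facts $T_{k+d-1}(\vec x)$, respectively $R_d(\vec x)$; their arity is $\kappa=k+d-1$, respectively $\kappa=k2^{d-1}$. Each base fact is erased independently with probability $\varepsilon$, leaving $\tilde B$. A scheme assigns to every depth-$d$ query $q$ with pairwise distinct coordinates a finite set $S$ of facts derivable from $B$ such that $q$ is derivable from $\tilde B\cup S$ with probability at least $1-\delta$. The facts of $S$ are stored one by one, a fact with $a$ coordinates in $\lceil a\log m\rceil$ bits, and $\sigma^*_{\mathrm{unc}}$ is the least $\sigma$ for which some scheme uses at most $\sigma$ bits for every such $q$. *Dispersion.* A minimum cache $\sigma^*$ has dispersion $V(m)\ge 0$ at first-order rate $R(m)$ on a range of parameters if, uniformly over that range, $\sigma^*=\kappa R(m)+\sqrt{\kappa V(m)}\,\Phi^{-1}(1-\delta)+O(\log m)$. 1. *Coded scheme.* At first-order rate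 $\varepsilon\log m$, the minimum coded cache has dispersion $V_{\mathrm{cache}}$, that is, $$\sigma^*_{\mathrm{code}}=\kappa\varepsilon\log m+\sqrt{\kappa V_{\mathrm{cache}}}\;\Phi^{-1}(1-\delta)+O(\log m),$$ both for $\mathcal Q=[m]^\kappa$ on the range $m\ge2$, $1\le\kappa\le m$, and, for each fixed $A$, for the tuples with pairwise distinct coordinates on the range $m\ge2$, $1\le\kappa\le m$, $\kappa^2\le Am$. The second-order term $\sqrt{\kappa V_{\mathrm{cache}}}\,\Phi^{-1}(1-\delta)$ is $O(\sqrt\kappa\log m)$, and $\Theta(\sqrt\kappa\log m)$ if $\delta\neq\frac12$. If $\delta\ne\frac12$, then $v=\varepsilon(1-\varepsilon)$ is the only real $v$ for which $v(\log m)^2$ is a dispersion on these ranges ($A\ge1$). 2. *Derivation-constrained scheme.* For $\kappa\le m$ and $\kappa\ge N^*$, with $\varepsilon,\delta,k$ fixed, $\sigma^*_{\mathrm{unc}}=(\kappa-N^*)\log m+O(\log\kappa)$, where $N^*$ does not depend on $\kappa$ or $m$. Moreover $\sigma^*_{\mathrm{unc}}-\kappa\log m=O(\log m)$ for all $\kappa\le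 m$. 3. *Effective dispersion.* At first-order rate $\log m$, $\sigma^*_{\mathrm{unc}}$ has dispersion $V_{\mathrm{unc}}=0$ on the range $\kappa\le m$; if $\delta\ne\frac12$, then $v=0$ is the only real $v$ for which $v(\log m)^2$ is a dispersion. -/

import Mathlib

noncomputable section

namespace Dispersion

/-! ### Independent erasures -/

/-- Probability that exactly the elements of `E` are erased, when every element of `ι` is erased
independently with probability `ε`. -/
def erasureWeight {ι : Type*} [Fintype ι] [DecidableEq ι] (ε : ℝ) (E : Finset ι) : ℝ :=
  ∏ i : ι, if i ∈ E then ε else 1 - ε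

open Classical in
/-- Probability of the event `P` about the random set of erased elements of `ι`. -/
def erasureProb {ι : Type*} [Fintype ι] [DecidableEq ι] (ε : ℝ) (P : Finset ι → Prop) : ℝ :=
  ∑ E : Finset ι, if P E then erasureWeight ε E else 0

/-! ### Queries and the `m`-ary erasure channel -/

/-- The output of `κ` uses of the `m`-ary erasure channel on the input `x`, when the set of erased
positions is `E`; an erased symbol is received as `none`. -/
def channelOutput {m κ : ℕ} (x : Fin κ → Fin m) (E : Finset (Fin κ)) : Fin κ → Option (Fin m) :=
  fun j => if j ∈ E then none else some (x j)

/-- The head tuples of the distinct-coordinate queries. -/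
def distinctTuples (m κ : ℕ) : Set (Fin κ → Fin m) := {x | Function.Injective x}

/-! ### Coded caching -/

/-- A coded caching scheme with `σ` cache bits, for queries with head tuple in `[m]^κ`. The decoder
sees the channel output and the cache string, and may declare failure (`none`). -/
structure CodedScheme (m κ σ : ℕ) where
  enc : (Fin κ → Fin m) → (Fin σ → Bool)
  dec : (Fin κ → Option (Fin m)) → (Fin σ → Bool) → Option (Fin κ → Fin m)
  enc_computable : Computable enc
  dec_computable : Computable₂ dec

/-- Every query of the family `Q` is decoded correctly with probability at least `1 - δ`. -/
def CodedScheme.IsReliable {m κ σ : ℕ} (s : CodedScheme m κ σ) (Q : Set (Fin κ → Fin m))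
    (ε δ : ℝ) : Prop :=
  ∀ q ∈ Q, 1 - δ ≤ erasureProb ε (fun E => s.dec (channelOutput q E) (s.enc q) = some q)

/-- The minimum number of cache bits of a `δ`-reliable coded scheme for the family `Q`. -/
def minCodedCache {m κ : ℕ} (Q : Set (Fin κ → Fin m)) (ε δ : ℝ) : ℕ :=
  sInf {σ : ℕ | ∃ s : CodedScheme m κ σ, s.IsReliable Q ε δ}

/-! ### Datalog programs and derivation-constrained caching -/

/-- Ground facts: the base facts `A(i)`, `i ∈ [m]`, and the derived facts `T_n(x)` (chain program)
or `R_n(x)` (merge program), with relation index `n` and head tuple `x`. -/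
inductive Fact (m : ℕ) : Type
  | base (i : Fin m) : Fact m
  | derived (n : ℕ) (x : List (Fin m)) : Fact m

/-- Number of coordinates of a fact. -/
def Fact.arity {m : ℕ} : Fact m → ℕ
  | .base _ => 1
  | .derived _ x => x.length

/-- Ground rule instances (body, head) of the tuple-assembly chain program:
`T_k(x₁,…,x_k) ← A(x₁),…,A(x_k)` and `T_{n+1}(x,i) ← T_n(x), A(i)` for `n ≥ k`. -/
inductive ChainRule (m k : ℕ) : List (Fact m) → Fact m → Prop
  | init (x : List (Fin m)) (hx : x.length = k) :
      ChainRule m k (x.map Fact.base) (.derived k x)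
  | extend (n : ℕ) (x : List (Fin m)) (i : Fin m) (hn : k ≤ n) (hx : x.length = n) :
      ChainRule m k [.derived n x, .base i] (.derived (n + 1) (x ++ [i]))

/-- Ground rule instances (body, head) of the balanced-merge program:
`R_1(x₁,…,x_k) ← A(x₁),…,A(x_k)` and `R_{d+1}(x,y) ← R_d(x), R_d(y)` for `d ≥ 1`, where `R_d` has
arity `k 2^(d-1)`. -/
inductive MergeRule (m k : ℕ) : List (Fact m) → Fact m → Prop
  | init (x : List (Fin m)) (hx : x.length = k) :
      MergeRule m k (x.map Fact.base) (.derived 1 x)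
  | merge (d : ℕ) (x y : List (Fin m)) (hd : 1 ≤ d)
      (hx : x.length = k * 2 ^ (d - 1)) (hy : y.length = k * 2 ^ (d - 1)) :
      MergeRule m k [.derived d x, .derived d y] (.derived (d + 1) (x ++ y))

/-- `Cn rules Γ f`: the fact `f` is derivable from the premises `Γ` with the given rules. -/
inductive Cn {m : ℕ} (rules : List (Fact m) → Fact m → Prop) (Γ : Set (Fact m)) : Fact m → Prop
  | premise (f : Fact m) (hf : f ∈ Γ) : Cn rules Γ f
  | step (body : List (Fact m)) (f : Fact m) (hr : rules body f)
      (hb : ∀ b ∈ body, Cn rules Γ b) : Cn rules Γ f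

/-- The two derivation architectures. -/
inductive Architecture : Type
  | chain
  | merge

/-- The ground rules of the program with parameter `k`. -/
def Architecture.rules (arch : Architecture) (m k : ℕ) : List (Fact m) → Fact m → Prop :=
  match arch with
  | .chain => ChainRule m k
  | .merge => MergeRule m k

/-- The head arity `κ` of the depth-`d` queries (`d ≥ 1`). -/
def Architecture.arity (arch : Architecture) (k d : ℕ) : ℕ :=
  match arch with
  | .chain => k + d - 1
  | .merge => k * 2 ^ (d - 1)

/-- The depth-`d` query with head tuple `x`. -/
def Architecture.query (arch : Architecture) (k d : ℕ) {m : ℕ}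
    (x : Fin (arch.arity k d) → Fin m) : Fact m :=
  match arch with
  | .chain => .derived (k + d - 1) (List.ofFn x)
  | .merge => .derived d (List.ofFn x)

/-- The premise base `B = {A(i) : i ∈ [m]}`. -/
def premiseBase (m : ℕ) : Set (Fact m) := Set.range Fact.base

/-- The premise base that is left when the facts `A(i)`, `i ∈ E`, are erased. -/
def survivingBase {m : ℕ} (E : Finset (Fin m)) : Set (Fact m) := Fact.base '' {i | i ∉ E}

/-- The number of bits in which the facts of `S` are written down, fact by fact: a fact with `a`
coordinates is stored as its head tuple, an element of `[m]^a`, in `⌈a log₂ m⌉` bits. -/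
def storageBits {m : ℕ} (S : Finset (Fact m)) : ℕ :=
  ∑ f ∈ S, Nat.clog 2 (m ^ f.arity)

/-- `S` assigns to each distinct-coordinate query of depth `d` a cache of at most `σ` bits, made of
facts derivable from the base, with which the query remains derivable from the surviving base with
probability at least `1 - δ`. -/
def IsDerivationScheme (arch : Architecture) (k d m : ℕ) (ε δ : ℝ) (σ : ℕ)
    (S : (Fin (arch.arity k d) → Fin m) → Finset (Fact m)) : Prop :=
  ∀ x ∈ distinctTuples m (arch.arity k d),
    (∀ f ∈ S x, Cn (arch.rules m k) (premiseBase m) f) ∧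
    storageBits (S x) ≤ σ ∧
    1 - δ ≤ erasureProb ε (fun E : Finset (Fin m) =>
      Cn (arch.rules m k) (survivingBase E ∪ (S x : Set (Fact m))) (arch.query k d x))

/-- The minimum number of cache bits of a `δ`-reliable derivation-constrained scheme. -/
def minDerivationCache (arch : Architecture) (k d m : ℕ) (ε δ : ℝ) : ℕ :=
  sInf {σ : ℕ | ∃ S, IsDerivationScheme arch k d m ε δ σ S}

/-! ### Second-order quantities -/

/-- The standard normal quantile function `Φ⁻¹`. -/
def normalQuantile (p : ℝ) : ℝ :=
  sInf {x : ℝ | p ≤ ProbabilityTheory.cdf (ProbabilityTheory.gaussianReal 0 1) x}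

/-- The resilience threshold `N*(ε, δ)`. -/
def resilienceThreshold (ε δ : ℝ) : ℕ :=
  ⌊Real.log (1 / (1 - δ)) / Real.log (1 / (1 - ε))⌋₊

/-- The cache dispersion `ε (1 - ε) (log₂ m)²`. -/
def cacheDispersion (ε : ℝ) (m : ℕ) : ℝ := ε * (1 - ε) * Real.logb 2 m ^ 2

/-- The minimum cache `σ`, indexed by the pairs `p` in a parameter range `I`, with base size
`m p` and dependency count `κ p`, has the second-order expansion
`σ = κ R(m) + √(κ V(m)) Φ⁻¹(1 - δ) + O(log m)`, uniformly over `I`, with `V ≥ 0`. -/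
def HasDispersion (δ : ℝ) (I : Set (ℕ × ℕ)) (m κ : ℕ × ℕ → ℕ) (σ : ℕ × ℕ → ℝ)
    (R V : ℕ → ℝ) : Prop :=
  (∀ n, 0 ≤ V n) ∧
  ∃ C : ℝ, ∀ p ∈ I,
    |σ p - (κ p * R (m p) + √(κ p * V (m p)) * normalQuantile (1 - δ))|
      ≤ C * Real.logb 2 (m p)

end Dispersion

end

/-!
A coded cache pays for the number of erased positions and hence for its fluctuations, a
derivation-constrained cache pays for the positions themselves, up to the boundedly many whose
survival is likely enough.

*Coded caching.* The number `S` of erased positions is binomial. A decoder that faces at least `t`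
erasures has at most `2 ^ σ m ^ (κ - t)` possible inputs, so averaging over the queries forces
`σ ≥ t log m - O(log m)` as soon as `S < t` has probability less than `1 - δ` by a margin of order
`1 / κ` (`card_mul_one_sub_le_of_isReliable`). Conversely, a random hash of `t log m + O(log m)` bits
resolves up to `t` erasures for most queries. Since the encoder sees the query, `κ + 1` hash
functions, each chosen greedily for the queries that its predecessors do not serve, serve every
query, and the index of the function costs only `O(log m)` further bits (`exists_codedScheme`).
Both bounds put `t` at the `(1 - δ)`-quantile of `S`, which has to be located up to `O(1)`. This
takes a Berry–Esseen bound of the optimal order (`binomial_berry_esseen`). It follows from Stein's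
method: summation by parts gives `E[(S - nε) g(S)] = ε E[(n - S) (g(S + 1) - g(S))]`, which is
compared with Stein's equation `f'(w) - w f(w) = 1_{w ≤ z} - Φ(z)`, whose solution and its
derivative are bounded uniformly in `z`.

*Derivation-constrained caching.* No rule invents coordinates, so every coordinate of the query
that occurs in no cached fact must survive. At most `N*` coordinates can be left to this risk, and
the others cost `log m` bits each (`le_of_isDerivationScheme`). Conversely, a prefix of the query
is covered by boundedly many facts of the chain program, and in the merge program by at most one
fact per level of the derivation tree and boundedly many base facts; the rounding of the lengths
costs one bit per fact (`Architecture.exists_hasPrefixCover`). No term of order `√κ log m`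
appears.

The dispersion is unique because the quantile does not vanish for `δ ≠ 1 / 2` and `κ` is unbounded
on the ranges in question (`HasDispersion.coeff_unique`).
-/

namespace Dispersion

open MeasureTheory ProbabilityTheory Filter Topology Set

/-! ### The normal distribution function -/

/-- The distribution function `Φ` of the standard normal law. -/
noncomputable def normalCDF (x : ℝ) : ℝ := cdf (gaussianReal 0 1) x

/-- The density `φ` of the standard normal law. -/
noncomputable def normalPDF (x : ℝ) : ℝ := gaussianPDFReal 0 1 x

lemma normalPDF_eq (x : ℝ) : normalPDF x = (√(2 * Real.pi))⁻¹ * Real.exp (-x ^ 2 / 2) := by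
  simp [normalPDF, gaussianPDFReal]

lemma normalPDF_pos (x : ℝ) : 0 < normalPDF x := gaussianPDFReal_pos 0 1 x one_ne_zero

lemma hasDerivAt_normalPDF (x : ℝ) : HasDerivAt normalPDF (-x * normalPDF x) x := by
  have h1 : HasDerivAt (fun y : ℝ => -y ^ 2 / 2) (-x) x := by
    have := ((hasDerivAt_pow 2 x).neg.div_const 2)
    refine this.congr_deriv ?_
    simp only [Nat.cast_ofNat]
    ring
  have h2 := (h1.exp).const_mul (√(2 * Real.pi))⁻¹
  rw [show normalPDF = fun y => (√(2 * Real.pi))⁻¹ * Real.exp (-y ^ 2 / 2) from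
    funext normalPDF_eq]
  refine h2.congr_deriv ?_
  ring

lemma continuous_normalPDF : Continuous normalPDF :=
  continuous_iff_continuousAt.2 fun x => (hasDerivAt_normalPDF x).continuousAt

lemma normalCDF_eq_integral (x : ℝ) : normalCDF x = ∫ y in Iic x, normalPDF y := by
  rw [normalCDF, cdf_eq_real, Measure.real, gaussianReal_apply_eq_integral 0 one_ne_zero,
    ENNReal.toReal_ofReal]
  · rfl
  · exact integral_nonneg fun y => gaussianPDFReal_nonneg 0 1 y

lemma hasDerivAt_normalCDF (x : ℝ) : HasDerivAt normalCDF (normalPDF x) x := by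
  have hint : Integrable normalPDF := integrable_gaussianPDFReal 0 1
  have h : normalCDF = fun y => normalCDF 0 + ∫ t in (0 : ℝ)..y, normalPDF t := by
    funext y
    rw [← intervalIntegral.integral_Iic_sub_Iic hint.integrableOn hint.integrableOn,
      ← normalCDF_eq_integral, ← normalCDF_eq_integral]
    ring
  rw [h]
  exact (continuous_normalPDF.integral_hasStrictDerivAt 0 x).hasDerivAt.const_add _

lemma continuous_normalCDF : Continuous normalCDF :=
  continuous_iff_continuousAt.2 fun x => (hasDerivAt_normalCDF x).continuousAt

lemma monotone_normalCDF : Monotone normalCDF := monotone_cdf _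

lemma normalCDF_nonneg (x : ℝ) : 0 ≤ normalCDF x := cdf_nonneg _ x

lemma normalCDF_le_one (x : ℝ) : normalCDF x ≤ 1 := cdf_le_one _ x

lemma strictMono_normalCDF : StrictMono normalCDF := by
  apply strictMono_of_deriv_pos
  intro x
  rw [(hasDerivAt_normalCDF x).deriv]
  exact normalPDF_pos x

lemma normalCDF_neg (x : ℝ) : normalCDF (-x) = 1 - normalCDF x := by
  have hd : ∀ y, HasDerivAt (fun y => normalCDF (-y) + normalCDF y) 0 y := by
    intro y
    have h1 : HasDerivAt (fun y => normalCDF (-y)) (normalPDF (-y) * -1) y :=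
      (hasDerivAt_normalCDF (-y)).comp y (hasDerivAt_neg y)
    refine (h1.add (hasDerivAt_normalCDF y)).congr_deriv ?_
    simp [normalPDF_eq]
  have hc : ∀ y, normalCDF (-y) + normalCDF y = normalCDF (-x) + normalCDF x := fun y =>
    is_const_of_deriv_eq_zero (fun y => (hd y).differentiableAt) (fun y => (hd y).deriv) y x
  have hlim : Tendsto (fun y => normalCDF (-y) + normalCDF y) atTop (𝓝 (0 + 1)) :=
    ((tendsto_cdf_atBot (gaussianReal 0 1)).comp tendsto_neg_atTop_atBot).add
      (tendsto_cdf_atTop _)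
  have := tendsto_nhds_unique (hlim.congr hc) tendsto_const_nhds
  linarith

lemma normalCDF_zero : normalCDF 0 = 1 / 2 := by
  have := normalCDF_neg 0
  simp only [neg_zero] at this
  linarith

/-- The infimum that defines the quantile is attained, by continuity of `Φ`. -/
lemma normalCDF_normalQuantile {p : ℝ} (hp₀ : 0 < p) (hp₁ : p < 1) :
    normalCDF (normalQuantile p) = p := by
  obtain ⟨x, hx⟩ : ∃ x, normalCDF x = p := by
    obtain ⟨a, ha⟩ := ((tendsto_cdf_atBot (gaussianReal 0 1)).eventually_lt_const hp₀).exists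
    obtain ⟨b, hb⟩ := ((tendsto_cdf_atTop (gaussianReal 0 1)).eventually_const_lt hp₁).exists
    exact mem_range_of_exists_le_of_exists_ge continuous_normalCDF ⟨a, ha.le⟩ ⟨b, hb.le⟩
  have hq : normalQuantile p = x := by
    have : {y : ℝ | p ≤ cdf (gaussianReal 0 1) y} = Ici x := by
      ext y
      change p ≤ normalCDF y ↔ x ≤ y
      rw [← hx, strictMono_normalCDF.le_iff_le]
    rw [normalQuantile, this, csInf_Ici]
  rw [hq, hx]

/-- The upper bound on Mills' ratio: `w (1 - Φ(w)) ≤ φ(w)` for `w > 0`, because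
`φ(w)/w - (1 - Φ(w))` has derivative `-φ(w)/w²` and tends to `0`. -/
lemma mul_one_sub_normalCDF_le {w : ℝ} (hw : 0 < w) : w * (1 - normalCDF w) ≤ normalPDF w := by
  have hd : ∀ x ∈ Ioi (0 : ℝ), HasDerivAt (fun x => normalPDF x / x - (1 - normalCDF x))
      (-(normalPDF x / x ^ 2)) x := by
    intro x hx
    have hx0 : x ≠ 0 := ne_of_gt hx
    refine (((hasDerivAt_normalPDF x).div (hasDerivAt_id x) hx0).sub
      ((hasDerivAt_normalCDF x).const_sub 1)).congr_deriv ?_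
    simp only [id_eq]
    field_simp
    ring
  have hanti : AntitoneOn (fun x => normalPDF x / x - (1 - normalCDF x)) (Ioi (0 : ℝ)) := by
    apply antitoneOn_of_deriv_nonpos (convex_Ioi 0)
    · exact fun x hx => (hd x hx).continuousAt.continuousWithinAt
    · rw [interior_Ioi]
      exact fun x hx => (hd x hx).differentiableAt.differentiableWithinAt
    · rw [interior_Ioi]
      intro x hx
      rw [(hd x hx).deriv]
      have := (normalPDF_pos x).le
      have : 0 ≤ normalPDF x / x ^ 2 := by positivity
      linarith
  have hbd : ∀ x, normalPDF x ≤ normalPDF 0 := by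
    intro x
    rw [normalPDF_eq, normalPDF_eq]
    exact mul_le_mul_of_nonneg_left (Real.exp_le_exp.2 (by nlinarith [sq_nonneg x]))
      (by positivity)
  have hlim1 : Tendsto (fun x => normalPDF x / x) atTop (𝓝 0) := by
    refine squeeze_zero' (g := fun x => normalPDF 0 / x) ?_ ?_
      (tendsto_const_nhds.div_atTop tendsto_id)
    · filter_upwards [eventually_gt_atTop 0] with x hx
      exact div_nonneg (normalPDF_pos x).le hx.le
    · filter_upwards [eventually_gt_atTop 0] with x hx
      exact div_le_div_of_nonneg_right (hbd x) hx.le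
  have hlim : Tendsto (fun x => normalPDF x / x - (1 - normalCDF x)) atTop (𝓝 (0 - (1 - 1))) :=
    hlim1.sub (tendsto_const_nhds.sub (tendsto_cdf_atTop (gaussianReal 0 1)))
  have h0 : 0 - (1 - 1) ≤ normalPDF w / w - (1 - normalCDF w) := by
    refine le_of_tendsto hlim ?_
    filter_upwards [eventually_ge_atTop w] with x hx
    exact hanti hw (lt_of_lt_of_le hw hx) hx
  have h1 : 1 - normalCDF w ≤ normalPDF w / w := by linarith
  rw [le_div_iff₀ hw] at h1
  linarith

/-! ### Stein's equation for the half-line -/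

/-- The bounded solution of Stein's equation `f'(w) - w f(w) = 1_{w ≤ z} - Φ(z)`. -/
noncomputable def steinSol (z w : ℝ) : ℝ :=
  normalCDF (min w z) * (1 - normalCDF (max w z)) / normalPDF w

/-- The derivative of `steinSol z` away from `z`, as Stein's equation gives it. -/
noncomputable def steinDeriv (z w : ℝ) : ℝ :=
  w * steinSol z w + (if w ≤ z then 1 else 0) - normalCDF z

lemma continuous_steinSol (z : ℝ) : Continuous (steinSol z) := by
  unfold steinSol
  refine Continuous.div ?_ continuous_normalPDF fun w => (normalPDF_pos w).ne'
  exact (continuous_normalCDF.comp (by fun_prop)).mul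
    (continuous_const.sub (continuous_normalCDF.comp (by fun_prop)))

lemma hasDerivAt_steinSol {z w : ℝ} (hw : w ≠ z) :
    HasDerivAt (steinSol z) (steinDeriv z w) w := by
  have hp := (normalPDF_pos w).ne'
  rcases lt_or_gt_of_ne hw with h | h
  · have h1 : HasDerivAt (fun w => normalCDF w * (1 - normalCDF z) / normalPDF w)
        (steinDeriv z w) w := by
      refine (((hasDerivAt_normalCDF w).mul_const (1 - normalCDF z)).div
        (hasDerivAt_normalPDF w) hp).congr_deriv ?_
      rw [steinDeriv, if_pos h.le, steinSol, min_eq_left h.le, max_eq_right h.le]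
      field_simp
      ring
    refine h1.congr_of_eventuallyEq ?_
    filter_upwards [eventually_lt_nhds h] with x hx
    rw [steinSol, min_eq_left hx.le, max_eq_right hx.le]
  · have h1 : HasDerivAt (fun w => normalCDF z * (1 - normalCDF w) / normalPDF w)
        (steinDeriv z w) w := by
      refine ((((hasDerivAt_normalCDF w).const_sub 1).const_mul (normalCDF z)).div
        (hasDerivAt_normalPDF w) hp).congr_deriv ?_
      rw [steinDeriv, if_neg (not_le.2 h), steinSol, min_eq_right h.le, max_eq_left h.le]
      field_simp
      ring
    refine h1.congr_of_eventuallyEq ?_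
    filter_upwards [eventually_gt_nhds h] with x hx
    rw [steinSol, min_eq_right hx.le, max_eq_left hx.le]

lemma steinSol_nonneg (z w : ℝ) : 0 ≤ steinSol z w := by
  have := normalCDF_le_one (max w z)
  exact div_nonneg (mul_nonneg (normalCDF_nonneg _) (by linarith)) (normalPDF_pos w).le

/-- A bound on the Stein solution that does not depend on `z`. -/
lemma steinSol_le (z w : ℝ) :
    steinSol z w ≤ normalCDF w * (1 - normalCDF w) / normalPDF w := by
  unfold steinSol
  have h1 := monotone_normalCDF (min_le_left w z)
  have h2 := monotone_normalCDF (le_max_left w z)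
  have h3 := normalCDF_le_one (max w z)
  have := (normalPDF_pos w).le
  have h4 := normalCDF_nonneg w
  gcongr

lemma abs_mul_steinSol_le_one (z w : ℝ) : |w * steinSol z w| ≤ 1 := by
  rw [abs_mul, abs_of_nonneg (steinSol_nonneg z w)]
  have hp := normalPDF_pos w
  have h0 := normalCDF_nonneg w
  have h1 := normalCDF_le_one w
  refine (mul_le_mul_of_nonneg_left (steinSol_le z w) (abs_nonneg w)).trans ?_
  rw [← mul_div_assoc, div_le_one hp]
  rcases lt_trichotomy w 0 with hw | hw | hw
  · have := mul_one_sub_normalCDF_le (neg_pos.2 hw)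
    rw [normalCDF_neg, show normalPDF (-w) = normalPDF w by simp [normalPDF_eq]] at this
    rw [abs_of_neg hw]
    have h2 : -w * normalCDF w * (1 - normalCDF w) ≤ -w * normalCDF w * 1 :=
      mul_le_mul_of_nonneg_left (by linarith) (mul_nonneg (by linarith) h0)
    linarith
  · subst hw
    simp [hp.le]
  · have := mul_one_sub_normalCDF_le hw
    rw [abs_of_pos hw]
    have h2 : w * (1 - normalCDF w) * normalCDF w ≤ w * (1 - normalCDF w) * 1 :=
      mul_le_mul_of_nonneg_left h1 (mul_nonneg hw.le (by linarith))
    linarith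

lemma abs_steinSol_le_two (z w : ℝ) : |steinSol z w| ≤ 2 := by
  rcases le_or_gt 1 |w| with hw | hw
  · have h := abs_mul_steinSol_le_one z w
    rw [abs_mul] at h
    have : 1 * |steinSol z w| ≤ |w| * |steinSol z w| :=
      mul_le_mul_of_nonneg_right hw (abs_nonneg _)
    linarith
  · rw [abs_of_nonneg (steinSol_nonneg z w)]
    refine (steinSol_le z w).trans ?_
    rw [div_le_iff₀ (normalPDF_pos w)]
    have h1 : normalCDF w * (1 - normalCDF w) ≤ 1 / 4 := by
      nlinarith [sq_nonneg (normalCDF w - 1 / 2)]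
    -- on `|w| ≤ 1` the density is at least `e^{-1/2} / √(2π) ≥ 1/8`
    have h2 : 1 / 8 ≤ normalPDF w := by
      rw [normalPDF_eq]
      have hs : √(2 * Real.pi) ≤ 3 := by
        rw [Real.sqrt_le_iff]
        constructor
        · norm_num
        · nlinarith [Real.pi_lt_four]
      have hw2 : w ^ 2 ≤ 1 := by
        rw [← sq_abs]
        nlinarith [abs_nonneg w]
      have he : (1 : ℝ) / 2 ≤ Real.exp (-w ^ 2 / 2) := by
        have := Real.add_one_le_exp (-w ^ 2 / 2)
        linarith
      have hi : (1 : ℝ) / 3 ≤ (√(2 * Real.pi))⁻¹ := by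
        rw [one_div]
        exact inv_anti₀ (by positivity) hs
      nlinarith
    linarith

lemma abs_steinDeriv_le_two (z w : ℝ) : |steinDeriv z w| ≤ 2 := by
  have h := abs_le.1 (abs_mul_steinSol_le_one z w)
  have h0 := normalCDF_nonneg z
  have h1 := normalCDF_le_one z
  unfold steinDeriv
  rw [abs_le]
  split_ifs <;> constructor <;> linarith

/-- The mean value theorem for the Stein solution, on an interval whose interior avoids its kink. -/
lemma exists_steinDeriv_eq_slope {z a b : ℝ} (hab : a < b) (hz : z ∉ Ioo a b) :
    ∃ c ∈ Ioo a b, steinSol z b - steinSol z a = steinDeriv z c * (b - a) := by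
  obtain ⟨c, hc, h⟩ := exists_hasDerivAt_eq_slope (steinSol z) (steinDeriv z) hab
    (continuous_steinSol z).continuousOn
    (fun x hx => hasDerivAt_steinSol (fun h => hz (h ▸ hx)))
  refine ⟨c, hc, ?_⟩
  rw [h, div_mul_cancel₀ _ (sub_pos.2 hab).ne']

/-- The forward difference of the Stein solution over a step `h` approximates its derivative at the
left end `a`, up to the jump of the derivative when the kink is at `a`. -/
lemma abs_steinDeriv_sub_slope_le {z a h : ℝ} (hh : 0 < h) (hz : z ∉ Ioo a (a + h)) :
    |steinDeriv z a - (steinSol z (a + h) - steinSol z a) / h|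
      ≤ (2 * |a| + 2) * h + if a = z then 1 else 0 := by
  obtain ⟨c, hc, hs⟩ := exists_steinDeriv_eq_slope (z := z) (lt_add_of_pos_right a hh) hz
  have hslope : (steinSol z (a + h) - steinSol z a) / h = steinDeriv z c := by
    rw [hs]
    field_simp
    ring
  obtain ⟨ξ, hξ, hs'⟩ := exists_steinDeriv_eq_slope (z := z) hc.1
    (fun hx => hz ⟨hx.1, hx.2.trans hc.2⟩)
  have hf : |steinSol z c - steinSol z a| ≤ 2 * h := by
    rw [hs', abs_mul, abs_of_pos (sub_pos.2 hc.1)]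
    exact mul_le_mul (abs_steinDeriv_le_two z ξ) (by linarith [hc.2]) (by linarith [hc.1])
      zero_le_two
  have hind : |(if a ≤ z then (1 : ℝ) else 0) - (if c ≤ z then 1 else 0)|
      ≤ if a = z then 1 else 0 := by
    rcases lt_trichotomy a z with haz | haz | haz
    · have : c ≤ z := by
        by_contra hcz
        exact hz ⟨haz, (not_le.1 hcz).trans hc.2⟩
      simp [haz.le, this, haz.ne]
    · have : ¬ c ≤ z := not_le.2 (haz ▸ hc.1)
      simp [haz, this]
    · have : ¬ c ≤ z := not_le.2 (haz.trans hc.1)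
      simp [not_le.2 haz, this, haz.ne']
  have hmul : |a * steinSol z a - c * steinSol z c| ≤ (2 * |a| + 2) * h := by
    have e : a * steinSol z a - c * steinSol z c
        = -(a * (steinSol z c - steinSol z a)) - (c - a) * steinSol z c := by ring
    rw [e]
    refine (abs_sub _ _).trans ?_
    rw [abs_neg, abs_mul, abs_mul, abs_of_pos (sub_pos.2 hc.1)]
    have h1 := mul_le_mul_of_nonneg_left hf (abs_nonneg a)
    have h2 : (c - a) * |steinSol z c| ≤ h * 2 :=
      mul_le_mul (by linarith [hc.2]) (abs_steinSol_le_two z c) (abs_nonneg _) hh.le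
    linarith
  rw [hslope]
  have e : steinDeriv z a - steinDeriv z c = (a * steinSol z a - c * steinSol z c)
      + ((if a ≤ z then (1 : ℝ) else 0) - (if c ≤ z then 1 else 0)) := by
    unfold steinDeriv
    ring
  rw [e]
  exact (abs_add_le _ _).trans (add_le_add hmul hind)

/-- The Stein solution is `2`-Lipschitz across an interval whose interior avoids its kink. -/
lemma abs_steinSol_sub_le {z a h : ℝ} (hh : 0 < h) (hz : z ∉ Ioo a (a + h)) :
    |steinSol z (a + h) - steinSol z a| ≤ 2 * h := by
  obtain ⟨c, -, hs⟩ := exists_steinDeriv_eq_slope (z := z) (lt_add_of_pos_right a hh) hz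
  rw [hs, abs_mul, add_sub_cancel_left, abs_of_pos hh]
  exact mul_le_mul_of_nonneg_right (abs_steinDeriv_le_two z c) hh.le

end Dispersion

namespace Dispersion

open Finset

/-! ### The binomial law -/

/-- The binomial probability of `j` successes among `n` trials. -/
noncomputable def binWeight (n : ℕ) (ε : ℝ) (j : ℕ) : ℝ :=
  n.choose j * ε ^ j * (1 - ε) ^ (n - j)

/-- The expectation of `g` under the binomial law. -/
noncomputable def binE (n : ℕ) (ε : ℝ) (g : ℕ → ℝ) : ℝ :=
  ∑ j ∈ range (n + 1), binWeight n ε j * g j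

section

variable {n : ℕ} {ε : ℝ}

lemma binWeight_nonneg (hε₀ : 0 < ε) (hε₁ : ε < 1) (j : ℕ) : 0 ≤ binWeight n ε j := by
  have : 0 < 1 - ε := by linarith
  unfold binWeight
  positivity

lemma sum_binWeight (n : ℕ) (ε : ℝ) : ∑ j ∈ range (n + 1), binWeight n ε j = 1 := by
  have h := add_pow ε (1 - ε) n
  rw [add_sub_cancel, one_pow] at h
  rw [h]
  exact sum_congr rfl fun j _ => by unfold binWeight; ring

lemma binE_mono (hε₀ : 0 < ε) (hε₁ : ε < 1) {f g : ℕ → ℝ} (h : ∀ j, f j ≤ g j) :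
    binE n ε f ≤ binE n ε g :=
  sum_le_sum fun j _ => mul_le_mul_of_nonneg_left (h j) (binWeight_nonneg hε₀ hε₁ j)

lemma binE_const (n : ℕ) (ε c : ℝ) : binE n ε (fun _ => c) = c := by
  rw [binE, ← sum_mul, sum_binWeight, one_mul]

lemma binE_add (f g : ℕ → ℝ) : binE n ε (fun j => f j + g j) = binE n ε f + binE n ε g := by
  simp only [binE, mul_add, sum_add_distrib]

lemma binE_sub (f g : ℕ → ℝ) : binE n ε (fun j => f j - g j) = binE n ε f - binE n ε g := by
  simp only [binE, mul_sub, sum_sub_distrib]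

lemma binE_const_mul (c : ℝ) (f : ℕ → ℝ) : binE n ε (fun j => c * f j) = c * binE n ε f := by
  simp only [binE, mul_sum]
  exact sum_congr rfl fun j _ => by ring

lemma abs_binE_le (hε₀ : 0 < ε) (hε₁ : ε < 1) (f : ℕ → ℝ) :
    |binE n ε f| ≤ binE n ε (fun j => |f j|) := by
  refine (abs_sum_le_sum_abs _ _).trans (le_of_eq (sum_congr rfl fun j _ => ?_))
  rw [abs_mul, abs_of_nonneg (binWeight_nonneg hε₀ hε₁ j)]

lemma binWeight_succ {j : ℕ} (hj : j < n) :
    (1 - ε) * ((j + 1 : ℝ) * binWeight n ε (j + 1)) = ε * ((n - j : ℝ) * binWeight n ε j) := by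
  have h : (n.choose (j + 1) : ℝ) * (j + 1) = n.choose j * (n - j) := by
    have := Nat.choose_succ_right_eq n j
    have h2 : ((n.choose (j + 1) * (j + 1) : ℕ) : ℝ) = (n.choose j * (n - j) : ℕ) := by rw [this]
    push_cast [Nat.cast_sub hj.le] at h2
    exact h2
  have hp : n - j = n - (j + 1) + 1 := by omega
  unfold binWeight
  rw [hp, pow_succ, pow_succ]
  linear_combination ε * ε ^ j * (1 - ε) ^ (n - (j + 1)) * (1 - ε) * h

/-- Stein's identity for the binomial law, a summation by parts. -/
lemma binE_stein (g : ℕ → ℝ) :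
    binE n ε (fun j => (j - n * ε) * g j)
      = ε * binE n ε (fun j => (n - j) * (g (j + 1) - g j)) := by
  have key : (1 - ε) * binE n ε (fun j => j * g j)
      = ε * binE n ε (fun j => (n - j) * g (j + 1)) := by
    unfold binE
    rw [sum_range_succ', sum_range_succ, mul_add, mul_add, mul_sum, mul_sum]
    simp only [Nat.cast_zero, zero_mul, mul_zero, sub_self, add_zero]
    refine sum_congr rfl fun j hj => ?_
    have := binWeight_succ (ε := ε) (mem_range.1 hj)
    push_cast
    linear_combination g (j + 1) * this
  have e1 : binE n ε (fun j => (j - n * ε) * g j)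
      = (1 - ε) * binE n ε (fun j => j * g j) - ε * binE n ε (fun j => (n - j) * g j) := by
    rw [← binE_const_mul, ← binE_const_mul, ← binE_sub]
    congr 1
    funext j
    ring
  rw [e1, key, ← mul_sub, ← binE_sub]
  congr 2
  funext j
  ring

/-- The mean absolute deviation of the binomial law is at most its standard deviation. -/
lemma binE_abs_sub_le (hε₀ : 0 < ε) (hε₁ : ε < 1) :
    binE n ε (fun j => |(j : ℝ) - n * ε|) ≤ √(n * (ε * (1 - ε))) := by
  have hmean : binE n ε (fun j => (j : ℝ) - n * ε) = 0 := by
    have := binE_stein (n := n) (ε := ε) (fun _ => 1)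
    simp only [mul_one, sub_self, mul_zero, binE_const] at this
    exact this
  have hvar : binE n ε (fun j => ((j : ℝ) - n * ε) ^ 2) = n * (ε * (1 - ε)) := by
    have h := binE_stein (n := n) (ε := ε) (fun j => (j : ℝ) - n * ε)
    have e : binE n ε (fun j => (n - j) * (((j + 1 : ℕ) : ℝ) - n * ε - (j - n * ε)))
        = n * (1 - ε) := by
      have : (fun j : ℕ => ((n : ℝ) - j) * (((j + 1 : ℕ) : ℝ) - n * ε - (j - n * ε)))
          = fun j : ℕ => n * (1 - ε) - ((j : ℝ) - n * ε) := by
        funext j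
        push_cast
        ring
      rw [this, binE_sub, hmean, binE_const, sub_zero]
    rw [e] at h
    simp only [sq]
    rw [h]
    ring
  refine Real.le_sqrt_of_sq_le ?_
  set A := binE n ε (fun j => |(j : ℝ) - n * ε|)
  have h : 0 ≤ binE n ε (fun j => (|(j : ℝ) - n * ε| - A) ^ 2) := by
    rw [← binE_const n ε 0]
    exact binE_mono hε₀ hε₁ fun j => sq_nonneg _
  have e : (fun j : ℕ => (|(j : ℝ) - n * ε| - A) ^ 2)
      = fun j : ℕ => (((j : ℝ) - n * ε) ^ 2 - 2 * A * |(j : ℝ) - n * ε|) + A ^ 2 := by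
    funext j
    rw [sub_sq, sq_abs]
    ring
  rw [e, binE_add, binE_sub, binE_const_mul, binE_const, hvar] at h
  nlinarith

/-- Every binomial probability is `O(1/√n)`: Stein's identity for the indicator of an upper
half-line bounds `(n - t) p(t)` and `t p(t)` by the mean absolute deviation. -/
lemma binWeight_le (hε₀ : 0 < ε) (hε₁ : ε < 1) (hn : 1 ≤ n) (t : ℕ) :
    binWeight n ε t ≤ 2 / √(n * (ε * (1 - ε))) := by
  have hn0 : (0 : ℝ) < n := by exact_mod_cast hn
  have h1ε : 0 < 1 - ε := by linarith
  set s := √(n * (ε * (1 - ε))) with hs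
  have hs0 : 0 < s := Real.sqrt_pos.2 (by positivity)
  have hss : s * s = n * (ε * (1 - ε)) := Real.mul_self_sqrt (by positivity)
  rcases lt_or_ge n t with ht | ht
  · rw [binWeight, Nat.choose_eq_zero_of_lt ht]
    simp only [Nat.cast_zero, zero_mul]
    positivity
  have hmad := binE_abs_sub_le (n := n) hε₀ hε₁
  rw [← hs] at hmad
  have hhalf : ∀ g : ℕ → ℝ, (∀ j, |g j| ≤ 1) →
      binE n ε (fun j => (j - n * ε) * g j) ≤ s := fun g hg =>
    (binE_mono hε₀ hε₁ fun j => by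
      refine (le_abs_self _).trans ?_
      rw [abs_mul]
      exact mul_le_of_le_one_right (abs_nonneg _) (hg j)).trans hmad
  have hp := binWeight_nonneg (n := n) hε₀ hε₁ t
  -- the identity for the indicator of `{j > t}`
  have hB : ε * ((n - t : ℝ) * binWeight n ε t) ≤ s := by
    have h := hhalf (fun j => if t < j then 1 else 0) (fun j => by split_ifs <;> simp)
    rw [binE_stein] at h
    refine le_trans (le_of_eq ?_) h
    congr 1
    rw [binE, sum_eq_single t]
    · simp
      ring
    · intro j _ hj
      rcases lt_or_gt_of_ne hj with h | h
      · simp [not_le.2 h, not_lt.2 h.le]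
      · simp [h, h.le]
    · intro h
      exact absurd (mem_range.2 (Nat.lt_succ_of_le ht)) h
  have hA : (1 - ε) * ((t : ℝ) * binWeight n ε t) ≤ s := by
    rcases Nat.eq_zero_or_pos t with h0 | h0
    · subst h0
      simpa using hs0.le
    obtain ⟨r, rfl⟩ : ∃ r, t = r + 1 := ⟨t - 1, by omega⟩
    have hr : r < n := by omega
    have h := hhalf (fun j => if r < j then 1 else 0) (fun j => by split_ifs <;> simp)
    rw [binE_stein] at h
    push_cast
    rw [binWeight_succ hr]
    refine le_trans (le_of_eq ?_) h
    congr 1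
    rw [binE, sum_eq_single r]
    · simp
      ring
    · intro j _ hj
      rcases lt_or_gt_of_ne hj with h | h
      · simp [not_le.2 h, not_lt.2 h.le]
      · simp [h, h.le]
    · intro h
      exact absurd (mem_range.2 (Nat.lt_succ_of_lt hr)) h
  rw [le_div_iff₀ hs0]
  have hsum : n * (ε * (1 - ε)) * binWeight n ε t ≤ s := by
    have h1 := mul_le_mul_of_nonneg_left hB h1ε.le
    have h2 := mul_le_mul_of_nonneg_left hA hε₀.le
    linarith
  rw [← hss] at hsum
  have : s * (s * binWeight n ε t) ≤ s * 1 := by linarith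
  have := le_of_mul_le_mul_left this hs0
  linarith

/-- The Berry–Esseen bound for the binomial law, by Stein's method. -/
theorem binomial_berry_esseen (hε₀ : 0 < ε) (hε₁ : ε < 1) (hn : 1 ≤ n) (t : ℕ) :
    |binE n ε (fun j => if j ≤ t then 1 else 0)
        - normalCDF ((t - n * ε) / √(n * (ε * (1 - ε))))| ≤ 8 / √(n * (ε * (1 - ε))) := by
  have hn0 : (0 : ℝ) < n := by exact_mod_cast hn
  have h1ε : 0 < 1 - ε := by linarith
  set s := √(n * (ε * (1 - ε))) with hs
  have hs0 : 0 < s := Real.sqrt_pos.2 (by positivity)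
  have hss : s * s = n * (ε * (1 - ε)) := Real.mul_self_sqrt (by positivity)
  set z : ℝ := (t - n * ε) / s with hz
  let w : ℕ → ℝ := fun j => (j - n * ε) / s
  let g : ℕ → ℝ := fun j => steinSol z (w j)
  have hw1 : ∀ j, w (j + 1) = w j + 1 / s := by
    intro j
    simp only [w]
    push_cast
    field_simp
    ring
  have hwz : ∀ j, z ∉ Set.Ioo (w j) (w j + 1 / s) := by
    rintro j ⟨h1, h2⟩
    rw [← hw1] at h2
    have h1' := (div_lt_div_iff_of_pos_right hs0).1 h1
    have h2' := (div_lt_div_iff_of_pos_right hs0).1 h2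
    have h3 : (j : ℝ) < t := by linarith
    have h4 : (t : ℝ) < (j + 1 : ℕ) := by linarith
    have h5 : j < t := by exact_mod_cast h3
    have h6 : t < j + 1 := by exact_mod_cast h4
    omega
  have hle : ∀ j : ℕ, w j ≤ z ↔ j ≤ t := by
    intro j
    simp only [w, hz]
    rw [div_le_div_iff_of_pos_right hs0, sub_le_sub_iff_right, Nat.cast_le]
  have heq : ∀ j : ℕ, w j = z ↔ j = t := by
    intro j
    simp only [w, hz]
    rw [div_left_inj' hs0.ne', sub_left_inj, Nat.cast_inj]
  -- Stein's equation at `w j`, with the drift term replaced through Stein's identity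
  have hstein : binE n ε (fun j => if j ≤ t then 1 else 0) - normalCDF z
      = binE n ε (fun j => steinDeriv z (w j) - (g (j + 1) - g j) / (1 / s))
        + ε * binE n ε (fun j => w j * (g (j + 1) - g j)) := by
    have h1 : binE n ε (fun j => if j ≤ t then 1 else 0) - normalCDF z
        = binE n ε (fun j => steinDeriv z (w j)) - binE n ε (fun j => w j * g j) := by
      rw [← binE_sub, ← binE_const n ε (normalCDF z), ← binE_sub]
      congr 1
      funext j
      simp only [steinDeriv, hle, g]
      ring
    have h2 : binE n ε (fun j => w j * g j)
        = ε / s * binE n ε (fun j => (n - j) * (g (j + 1) - g j)) := by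
      have : (fun j : ℕ => w j * g j) = fun j : ℕ => 1 / s * ((j - n * ε) * g j) := by
        funext j
        simp only [w]
        ring
      rw [this, binE_const_mul, binE_stein]
      ring
    rw [h1, h2, ← binE_const_mul, ← binE_const_mul, ← binE_sub, ← binE_add]
    congr 1
    funext j
    have e : ε / s * (n * (1 - ε)) = s := by
      field_simp
      linarith
    simp only [w]
    rw [div_div_eq_mul_div, div_one]
    have hsi : s ≠ 0 := hs0.ne'
    linear_combination (-(g (j + 1) - g j)) * e
  rw [hstein]
  have hmad : binE n ε (fun j => |w j|) ≤ 1 := by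
    have : (fun j : ℕ => |w j|) = fun j : ℕ => 1 / s * |(j : ℝ) - n * ε| := by
      funext j
      simp only [w]
      rw [abs_div, abs_of_pos hs0]
      ring
    rw [this, binE_const_mul]
    have h := mul_le_mul_of_nonneg_left (binE_abs_sub_le (n := n) hε₀ hε₁)
      (one_div_pos.2 hs0).le
    rw [← hs, one_div_mul_cancel hs0.ne'] at h
    exact h
  have hT1 : |binE n ε (fun j => steinDeriv z (w j) - (g (j + 1) - g j) / (1 / s))| ≤ 6 / s := by
    refine (abs_binE_le hε₀ hε₁ _).trans ?_
    refine (binE_mono hε₀ hε₁ (g := fun j => (2 / s) * |w j| + 2 / s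
      + if j = t then 1 else 0) fun j => ?_).trans ?_
    · have h := abs_steinDeriv_sub_slope_le (z := z) (one_div_pos.2 hs0) (hwz j)
      rw [← hw1] at h
      simp only [heq] at h
      refine h.trans (le_of_eq ?_)
      ring
    · rw [binE_add, binE_add, binE_const_mul, binE_const]
      have hp : binE n ε (fun j => if j = t then 1 else 0) ≤ 2 / s := by
        simp only [binE, mul_ite, mul_one, mul_zero, sum_ite_eq']
        split_ifs
        · exact binWeight_le hε₀ hε₁ hn t
        · positivity
      have h2 := mul_le_mul_of_nonneg_left hmad (show 0 ≤ 2 / s by positivity)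
      have : 6 / s = 2 / s * 1 + 2 / s + 2 / s := by ring
      linarith
  have hT2 : |binE n ε (fun j => w j * (g (j + 1) - g j))| ≤ 2 / s := by
    refine (abs_binE_le hε₀ hε₁ _).trans ?_
    refine (binE_mono hε₀ hε₁ (g := fun j => (2 / s) * |w j|) fun j => ?_).trans ?_
    · have h := abs_steinSol_sub_le (z := z) (one_div_pos.2 hs0) (hwz j)
      rw [← hw1] at h
      rw [abs_mul]
      have := mul_le_mul_of_nonneg_left h (abs_nonneg (w j))
      refine this.trans (le_of_eq ?_)
      ring
    · rw [binE_const_mul]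
      have h2 := mul_le_mul_of_nonneg_left hmad (show 0 ≤ 2 / s by positivity)
      linarith
  refine (abs_add_le _ _).trans ?_
  rw [abs_mul, abs_of_pos hε₀]
  have h3 : ε * |binE n ε (fun j => w j * (g (j + 1) - g j))| ≤ 1 * (2 / s) :=
    mul_le_mul hε₁.le hT2 (abs_nonneg _) zero_le_one
  have : 8 / s = 6 / s + 1 * (2 / s) := by ring
  linarith

end

/-! ### The number of erased positions -/

lemma erasureWeight_eq {ι : Type*} [Fintype ι] [DecidableEq ι] (ε : ℝ) (E : Finset ι) :
    erasureWeight ε E = ε ^ #E * (1 - ε) ^ (Fintype.card ι - #E) := by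
  rw [erasureWeight, prod_ite, prod_const, prod_const, filter_mem_eq_inter, univ_inter]
  congr 2
  rw [← card_compl]
  congr 1
  ext i
  simp

/-- The number of erased positions is binomial. -/
lemma erasureProb_card (n : ℕ) (ε : ℝ) (P : ℕ → Prop) [DecidablePred P] :
    erasureProb ε (fun E : Finset (Fin n) => P #E) = binE n ε (fun j => if P j then 1 else 0) := by
  have h := sum_powerset_apply_card
    (fun j => @ite ℝ (P j) (Classical.propDecidable _) (ε ^ j * (1 - ε) ^ (n - j)) 0)
    (x := (univ : Finset (Fin n)))
  rw [powerset_univ, card_univ, Fintype.card_fin] at h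
  unfold erasureProb binE
  refine (sum_congr rfl fun E _ => ?_).trans (h.trans (sum_congr rfl fun j _ => ?_))
  · by_cases hP : P #E <;> simp [hP, erasureWeight_eq]
  by_cases hP : P j
  · simp only [hP, if_true, binWeight]
    rw [nsmul_eq_mul]
    ring
  · simp only [hP, if_false, mul_zero, smul_zero]

end Dispersion

namespace Dispersion

open Finset

/-! ### Second-order quantiles of the number of erasures -/

/-- `Φ` grows at least linearly near every point. -/
lemma exists_linear_growth_normalCDF (a : ℝ) : ∃ b : ℝ, 0 < b ∧ ∀ u : ℝ, 0 ≤ u → u ≤ 1 →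
    normalCDF a + b * u ≤ normalCDF (a + u) ∧ normalCDF (a - u) ≤ normalCDF a - b * u := by
  refine ⟨normalPDF (|a| + 1), normalPDF_pos _, fun u hu₀ hu₁ => ?_⟩
  have key := Convex.mul_sub_le_image_sub_of_le_deriv (convex_Icc (a - 1) (a + 1))
    continuous_normalCDF.continuousOn
    (fun x _ => (hasDerivAt_normalCDF x).differentiableAt.differentiableWithinAt)
    (C := normalPDF (|a| + 1)) (by
      intro x hx
      rw [interior_Icc] at hx
      rw [(hasDerivAt_normalCDF x).deriv, normalPDF_eq, normalPDF_eq]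
      have h : |x| ≤ |a| + 1 := by
        rw [abs_le]
        have := neg_abs_le a
        have := le_abs_self a
        constructor <;> linarith [hx.1, hx.2]
      have h2 : x ^ 2 ≤ (|a| + 1) ^ 2 := sq_le_sq' (by linarith [neg_abs_le x])
        ((le_abs_self x).trans h)
      exact mul_le_mul_of_nonneg_left (Real.exp_le_exp.2 (by linarith)) (by positivity))
  constructor
  · have := key a ⟨by linarith, by linarith⟩ (a + u) ⟨by linarith, by linarith⟩ (by linarith)
    rw [add_sub_cancel_left] at this
    linarith
  · have := key (a - u) ⟨by linarith, by linarith⟩ a ⟨by linarith, by linarith⟩ (by linarith)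
    rw [sub_sub_cancel] at this
    linarith

section

variable {ε δ : ℝ}

lemma sqrt_binVar_le (hε₀ : 0 < ε) (hε₁ : ε < 1) {κ : ℕ} (hκ : 1 ≤ κ) :
    √(κ * (ε * (1 - ε))) ≤ κ := by
  have h1 : (1 : ℝ) ≤ κ := by exact_mod_cast hκ
  rw [Real.sqrt_le_iff]
  refine ⟨by linarith, ?_⟩
  have : ε * (1 - ε) ≤ 1 := by nlinarith
  have : κ * (ε * (1 - ε)) ≤ κ * 1 := by gcongr
  nlinarith

/-- For bounded `κ`, the normal approximation of the quantile is bounded. -/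
lemma abs_mean_add_le (hε₀ : 0 < ε) (hε₁ : ε < 1) (a : ℝ) {κ : ℕ} (hκ : 1 ≤ κ) {B : ℝ}
    (hB : κ ≤ B) : |κ * ε + √(κ * (ε * (1 - ε))) * a| ≤ B + B * |a| := by
  have h0 : (0 : ℝ) ≤ κ := Nat.cast_nonneg κ
  refine (abs_add_le _ _).trans ?_
  rw [abs_mul, abs_mul, abs_of_nonneg h0, abs_of_pos hε₀, abs_of_nonneg (Real.sqrt_nonneg _)]
  have h1 := (sqrt_binVar_le hε₀ hε₁ hκ).trans hB
  have h2 : κ * ε ≤ κ * 1 := by gcongr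
  have h3 := mul_le_mul_of_nonneg_right h1 (abs_nonneg a)
  linarith

/-- For large `κ` the standard deviation exceeds `D` and the mean dominates the second-order
term. -/
lemma large_of_threshold_le (hε₀ : 0 < ε) (hε₁ : ε < 1) (a : ℝ) {D : ℝ} (hD : 0 < D) {κ : ℕ}
    (hκ : D ^ 2 / (ε * (1 - ε)) + a ^ 2 / ε ≤ κ) :
    D ≤ √(κ * (ε * (1 - ε))) ∧ 0 ≤ κ * ε + √(κ * (ε * (1 - ε))) * a := by
  have h1ε : 0 < 1 - ε := by linarith
  have hv : 0 < ε * (1 - ε) := by positivity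
  have h0 : (0 : ℝ) ≤ κ := Nat.cast_nonneg κ
  have e1 : 0 ≤ D ^ 2 / (ε * (1 - ε)) := by positivity
  have e2 : 0 ≤ a ^ 2 / ε := by positivity
  constructor
  · apply Real.le_sqrt_of_sq_le
    rw [← div_le_iff₀ hv]
    linarith
  · have h2 : a ^ 2 ≤ κ * ε := by
      rw [← div_le_iff₀ hε₀]
      linarith
    have h3 : |√(κ * (ε * (1 - ε))) * a| ≤ κ * ε := by
      apply abs_le_of_sq_le_sq _ (by positivity)
      rw [mul_pow, Real.sq_sqrt (by positivity)]
      have h4 : κ * (ε * (1 - ε)) ≤ κ * (ε * 1) := by gcongr; linarith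
      calc κ * (ε * (1 - ε)) * a ^ 2 ≤ κ * (ε * 1) * (κ * ε) := by gcongr
        _ = (κ * ε) ^ 2 := by ring
    linarith [(abs_le.1 h3).1]

/-- Above the normal approximation of its `(1 - δ)`-quantile, up to a constant, the number of
erasures falls with probability at most `δ`, with a margin of order `1/κ`. -/
lemma exists_erasures_upper_quantile (hε₀ : 0 < ε) (hε₁ : ε < 1) (hδ₀ : 0 < δ) (hδ₁ : δ < 1) :
    ∃ K : ℝ, ∀ κ : ℕ, 1 ≤ κ → ∃ t : ℕ,
      t ≤ κ * ε + √(κ * (ε * (1 - ε))) * normalQuantile (1 - δ) + K ∧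
      erasureProb ε (fun E : Finset (Fin κ) => t < #E) ≤ δ - δ / (2 * κ) := by
  set a := normalQuantile (1 - δ) with ha
  have hΦ : normalCDF a = 1 - δ := normalCDF_normalQuantile (by linarith) (by linarith)
  obtain ⟨b, hb, hgrow⟩ := exists_linear_growth_normalCDF a
  -- a shift by `9/b` outweighs the Berry–Esseen error `8/s` and leaves `1/s` to spare
  set D := 9 / b with hD
  have hD0 : 0 < D := by positivity
  set B := D ^ 2 / (ε * (1 - ε)) + a ^ 2 / ε with hB
  refine ⟨2 * B + B * |a| + D + 1, fun κ hκ => ?_⟩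
  have hκ0 : (0 : ℝ) < κ := by exact_mod_cast hκ
  have hκ1 : (1 : ℝ) ≤ κ := by exact_mod_cast hκ
  have h1ε : 0 < 1 - ε := by linarith
  have hB0 : 0 ≤ B := by positivity
  rcases le_or_gt B κ with h | h
  · obtain ⟨hs, hpos⟩ := large_of_threshold_le hε₀ hε₁ a hD0 h
    have hsκ := sqrt_binVar_le hε₀ hε₁ hκ
    have hbe := binomial_berry_esseen hε₀ hε₁ hκ
      ⌈κ * ε + √(κ * (ε * (1 - ε))) * a + D⌉₊
    set s := √(κ * (ε * (1 - ε)))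
    have hs0 : 0 < s := hD0.trans_le hs
    refine ⟨⌈κ * ε + s * a + D⌉₊, ?_, ?_⟩
    · have := (Nat.ceil_lt_add_one (by linarith : 0 ≤ κ * ε + s * a + D)).le
      have : 0 ≤ B * |a| := by positivity
      linarith
    · rw [erasureProb_card κ ε fun j => ⌈κ * ε + s * a + D⌉₊ < j]
      set t := ⌈κ * ε + s * a + D⌉₊
      have ht : κ * ε + s * a + D ≤ t := Nat.le_ceil _
      have e : binE κ ε (fun j => if t < j then 1 else 0)
          = 1 - binE κ ε (fun j => if j ≤ t then 1 else 0) := by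
        rw [eq_sub_iff_add_eq, ← binE_add]
        refine Eq.trans ?_ (binE_const κ ε 1)
        congr 1
        funext j
        by_cases hj : j ≤ t
        · simp [hj, not_lt.2 hj]
        · simp [hj, not_le.1 hj]
      have h1 : normalCDF (a + D / s) ≤ normalCDF ((t - κ * ε) / s) := by
        apply monotone_normalCDF
        rw [le_div_iff₀ hs0, add_mul, div_mul_cancel₀ _ hs0.ne']
        linarith
      have h2 := (hgrow (D / s) (by positivity) ((div_le_one hs0).2 hs)).1
      have h3 : b * (D / s) = 9 / s := by
        rw [hD]
        field_simp
      have h4 := (abs_le.1 hbe).1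
      have h5 : δ / (2 * κ) ≤ 1 / s := by
        apply div_le_div₀ zero_le_one hδ₁.le hs0
        linarith
      have h6 : 9 / s = 8 / s + 1 / s := by ring
      rw [e]
      linarith
  · refine ⟨κ, ?_, ?_⟩
    · have := (abs_le.1 (abs_mean_add_le hε₀ hε₁ a hκ h.le)).1
      linarith
    · rw [erasureProb_card κ ε fun j => κ < j]
      have e : binE κ ε (fun j => if κ < j then 1 else 0) = 0 := by
        refine sum_eq_zero fun j hj => ?_
        simp [Nat.lt_succ_iff.1 (mem_range.1 hj)]
      rw [e, sub_nonneg]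
      exact div_le_self hδ₀.le (by linarith)

/-- Below the normal approximation of its `(1 - δ)`-quantile, up to a constant, the number of
erasures falls with probability at most `1 - δ`, with a margin of order `1/κ`. -/
lemma exists_erasures_lower_quantile (hε₀ : 0 < ε) (hε₁ : ε < 1) (hδ₀ : 0 < δ) (hδ₁ : δ < 1) :
    ∃ K : ℝ, ∀ κ : ℕ, 1 ≤ κ → ∃ t : ℕ,
      κ * ε + √(κ * (ε * (1 - ε))) * normalQuantile (1 - δ) - K ≤ t ∧
      erasureProb ε (fun E : Finset (Fin κ) => #E < t) ≤ 1 - δ - (1 - δ) / κ := by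
  set a := normalQuantile (1 - δ) with ha
  have hΦ : normalCDF a = 1 - δ := normalCDF_normalQuantile (by linarith) (by linarith)
  obtain ⟨b, hb, hgrow⟩ := exists_linear_growth_normalCDF a
  set D := 9 / b with hD
  have hD0 : 0 < D := by positivity
  set B := D ^ 2 / (ε * (1 - ε)) + a ^ 2 / ε with hB
  refine ⟨B + B * |a| + D + 1, fun κ hκ => ?_⟩
  have hκ0 : (0 : ℝ) < κ := by exact_mod_cast hκ
  have hκ1 : (1 : ℝ) ≤ κ := by exact_mod_cast hκ
  have h1ε : 0 < 1 - ε := by linarith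
  have hB0 : 0 ≤ B := by positivity
  have hBa : 0 ≤ B * |a| := by positivity
  have hzero : erasureProb ε (fun E : Finset (Fin κ) => #E < 0) ≤ 1 - δ - (1 - δ) / κ := by
    have : erasureProb ε (fun E : Finset (Fin κ) => #E < 0) = 0 :=
      sum_eq_zero fun E _ => if_neg (Nat.not_lt_zero _)
    rw [this, sub_nonneg]
    exact div_le_self (by linarith) hκ1
  rcases le_or_gt B κ with h | h
  · obtain ⟨hs, hpos⟩ := large_of_threshold_le hε₀ hε₁ a hD0 h
    have hsκ := sqrt_binVar_le hε₀ hε₁ hκ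
    have hbe := binomial_berry_esseen hε₀ hε₁ hκ
      (⌊κ * ε + √(κ * (ε * (1 - ε))) * a - D⌋₊ - 1)
    set s := √(κ * (ε * (1 - ε)))
    have hs0 : 0 < s := hD0.trans_le hs
    rcases Nat.eq_zero_or_pos ⌊κ * ε + s * a - D⌋₊ with ht0 | ht0
    · refine ⟨0, ?_, hzero⟩
      have := Nat.floor_eq_zero.1 ht0
      push_cast
      linarith
    · refine ⟨⌊κ * ε + s * a - D⌋₊, ?_, ?_⟩
      · have := (Nat.lt_floor_add_one (κ * ε + s * a - D)).le
        linarith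
      · rw [erasureProb_card κ ε fun j => j < ⌊κ * ε + s * a - D⌋₊]
        have ht : (⌊κ * ε + s * a - D⌋₊ : ℝ) ≤ κ * ε + s * a - D :=
          Nat.floor_le (Nat.pos_of_floor_pos ht0).le
        set t := ⌊κ * ε + s * a - D⌋₊
        have e : binE κ ε (fun j => if j < t then 1 else 0)
            = binE κ ε (fun j => if j ≤ t - 1 then 1 else 0) := by
          congr 1
          funext j
          simp only [Nat.lt_iff_le_pred ht0]
        have h1 : normalCDF (((t - 1 : ℕ) - κ * ε) / s) ≤ normalCDF (a - D / s) := by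
          apply monotone_normalCDF
          rw [div_le_iff₀ hs0, sub_mul, div_mul_cancel₀ _ hs0.ne', Nat.cast_sub ht0]
          push_cast
          linarith
        have h2 := (hgrow (D / s) (by positivity) ((div_le_one hs0).2 hs)).2
        have h3 : b * (D / s) = 9 / s := by
          rw [hD]
          field_simp
        have h4 := (abs_le.1 hbe).2
        have h5 : (1 - δ) / κ ≤ 1 / s :=
          div_le_div₀ zero_le_one (by linarith) hs0 hsκ
        have h6 : 9 / s = 8 / s + 1 / s := by ring
        rw [e]
        linarith
  · refine ⟨0, ?_, hzero⟩
    have := (abs_le.1 (abs_mean_add_le hε₀ hε₁ a hκ h.le)).2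
    push_cast
    linarith

end

end Dispersion

namespace Dispersion

open Finset

/-! ### Erasure probabilities -/

section

variable {ι : Type*} [Fintype ι] [DecidableEq ι] {ε : ℝ}

lemma erasureWeight_nonneg (hε₀ : 0 < ε) (hε₁ : ε < 1) (E : Finset ι) :
    0 ≤ erasureWeight ε E :=
  prod_nonneg fun i _ => by split_ifs <;> linarith

lemma erasureProb_mono (hε₀ : 0 < ε) (hε₁ : ε < 1) {P Q : Finset ι → Prop}
    (h : ∀ E, P E → Q E) : erasureProb ε P ≤ erasureProb ε Q := by
  refine sum_le_sum fun E _ => ?_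
  have := erasureWeight_nonneg hε₀ hε₁ E
  by_cases hP : P E
  · simp [hP, h E hP]
  · by_cases hQ : Q E <;> simp [hP, hQ, this]

lemma erasureProb_or_le (hε₀ : 0 < ε) (hε₁ : ε < 1) (P Q : Finset ι → Prop) :
    erasureProb ε (fun E => P E ∨ Q E) ≤ erasureProb ε P + erasureProb ε Q := by
  unfold erasureProb
  rw [← sum_add_distrib]
  refine sum_le_sum fun E _ => ?_
  have := erasureWeight_nonneg hε₀ hε₁ E
  by_cases hP : P E <;> by_cases hQ : Q E <;> simp [hP, hQ, this]

/-- The probability that no element of `U` is erased. -/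
lemma erasureProb_disjoint (ε : ℝ) (U : Finset ι) :
    erasureProb ε (fun E => ∀ i ∈ U, i ∉ E) = (1 - ε) ^ #U := by
  have h := prod_add (fun i => if i ∈ U then 0 else ε) (fun _ => 1 - ε) (univ : Finset ι)
  rw [powerset_univ] at h
  have hl : ∏ i : ι, ((if i ∈ U then 0 else ε) + (1 - ε)) = (1 - ε) ^ #U := by
    rw [← prod_const, ← prod_subset (subset_univ U)]
    · exact prod_congr rfl fun i hi => by simp [hi]
    · intro i _ hi
      simp [hi]
  rw [← hl, h]
  refine sum_congr rfl fun E _ => ?_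
  by_cases hE : ∀ i ∈ U, i ∉ E
  · rw [if_pos hE, erasureWeight, prod_ite]
    congr 1
    · rw [filter_mem_eq_inter, univ_inter]
      exact prod_congr rfl fun i hi => (if_neg fun hU => hE i hU hi).symm
    · congr 1
      ext i
      simp
  · rw [if_neg hE]
    push Not at hE
    obtain ⟨i, hi, hiE⟩ := hE
    rw [prod_eq_zero hiE (by simp [hi]), zero_mul]

lemma sum_erasureWeight (ε : ℝ) : ∑ E : Finset ι, erasureWeight ε E = 1 := by
  have h := erasureProb_disjoint ε (∅ : Finset ι)
  simpa [erasureProb] using h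

lemma erasureProb_not (P : Finset ι → Prop) :
    erasureProb ε (fun E => ¬ P E) = 1 - erasureProb ε P := by
  rw [eq_sub_iff_add_eq, ← sum_erasureWeight (ι := ι) ε, erasureProb, erasureProb,
    ← sum_add_distrib]
  refine sum_congr rfl fun E _ => ?_
  by_cases hP : P E <;> simp [hP]

open Classical in
/-- Interchange of the sum over a finite family of events with the expectation over erasures. -/
lemma sum_erasureProb {α : Type*} (Q : Finset α) (P : α → Finset ι → Prop) :
    ∑ q ∈ Q, erasureProb ε (P q) = ∑ E, erasureWeight ε E * #{q ∈ Q | P q E} := by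
  unfold erasureProb
  rw [sum_comm]
  refine sum_congr rfl fun E _ => ?_
  rw [← sum_filter, sum_const, nsmul_eq_mul, mul_comm]

end

/-! ### Coded caching: achievability by greedily chosen random hash functions -/

section

variable {m κ : ℕ} {ε δ : ℝ}

/-- A map into a set of at most `2 ^ σ` values that, with the channel output, determines the query
with probability at least `1 - δ` yields a coded scheme with `σ` bits. All spaces are finite, so the
maps are computable. -/
lemma exists_codedScheme_of_enc {σ : ℕ} {Q : Set (Fin κ → Fin m)} {β : Type*} [Fintype β]
    (hβ : Fintype.card β ≤ 2 ^ σ) (enc : (Fin κ → Fin m) → β)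
    (hrel : ∀ q ∈ Q, 1 - δ ≤ erasureProb ε (fun E => ∀ q', channelOutput q' E = channelOutput q E →
      enc q' = enc q → q' = q)) (hε₀ : 0 < ε) (hε₁ : ε < 1) :
    ∃ s : CodedScheme m κ σ, s.IsReliable Q ε δ := by
  classical
  obtain ⟨e⟩ : Nonempty (β ↪ (Fin σ → Bool)) :=
    Function.Embedding.nonempty_of_card_le (by simpa using hβ)
  let cand (y : Fin κ → Option (Fin m)) (c : Fin σ → Bool) (q' : Fin κ → Fin m) : Prop :=
    channelOutput q' ({j | y j = none} : Finset (Fin κ)) = y ∧ e (enc q') = c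
  let dec (y : Fin κ → Option (Fin m)) (c : Fin σ → Bool) : Option (Fin κ → Fin m) :=
    if h : ∃ q', cand y c q' then some h.choose else none
  refine ⟨⟨fun q => e (enc q), dec, (Primrec.dom_finite _).to_comp,
    (Primrec.dom_finite _).to_comp⟩, fun q hq => (hrel q hq).trans ?_⟩
  refine erasureProb_mono hε₀ hε₁ fun E hE => ?_
  have hEy : ({j | channelOutput q E j = none} : Finset (Fin κ)) = E := by
    ext j
    simp [channelOutput]
  have hex : ∃ q', cand (channelOutput q E) (e (enc q)) q' := ⟨q, by rw [hEy], rfl⟩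
  have hspec := hex.choose_spec
  have h0 := hspec.1
  rw [hEy] at h0
  have h1 : hex.choose = q := hE _ h0 (e.injective hspec.2)
  change dec (channelOutput q E) (e (enc q)) = some q
  simp only [dec]
  rw [dif_pos hex, h1]

/-- A uniformly random function to `M` values identifies two given points with probability at most
`1 / M`. -/
lemma card_collision_mul_le {X : Type*} [Fintype X] [DecidableEq X] {M : ℕ} {q q' : X}
    (h : q ≠ q') : #{f : X → Fin M | f q = f q'} * M ≤ Fintype.card (X → Fin M) := by
  have : #(({f : X → Fin M | f q = f q'} : Finset (X → Fin M)) ×ˢ (univ : Finset (Fin M)))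
      ≤ #(univ : Finset (X → Fin M)) := by
    refine card_le_card_of_injOn (fun p => Function.update p.1 q p.2) (fun _ _ => by simp) ?_
    rintro ⟨f, c⟩ hf ⟨g, d⟩ hg hfg
    have hf' : f q = f q' := by simpa using hf
    have hg' : g q = g q' := by simpa using hg
    have hoff : ∀ x, x ≠ q → f x = g x := by
      intro x hx
      have := congrFun hfg x
      simpa [hx] using this
    have hcd : c = d := by simpa using congrFun hfg q
    have hq : f q = g q := by rw [hf', hg', hoff q' h.symm]
    refine Prod.ext (funext fun x => ?_) hcd
    by_cases hx : x = q
    · rw [hx]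
      exact hq
    · exact hoff x hx
  rw [card_product, card_univ, card_univ, Fintype.card_fin] at this
  exact this

/-- At most `m ^ #E` queries agree with `q` off `E`. -/
lemma card_channelOutput_eq_le (q : Fin κ → Fin m) (E : Finset (Fin κ)) :
    #{q' : Fin κ → Fin m | channelOutput q' E = channelOutput q E} ≤ m ^ #E := by
  have h : #{q' : Fin κ → Fin m | channelOutput q' E = channelOutput q E}
      ≤ #(univ : Finset (E → Fin m)) := by
    refine card_le_card_of_injOn (fun q' j => q' j) (fun _ _ => by simp) ?_
    intro x hx y hy hxy
    have hx' : channelOutput x E = channelOutput q E := by simpa using hx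
    have hy' : channelOutput y E = channelOutput q E := by simpa using hy
    funext j
    by_cases hj : j ∈ E
    · exact congrFun hxy ⟨j, hj⟩
    · have := congrFun (hx'.trans hy'.symm) j
      simpa [channelOutput, hj] using this
  simpa using h

/-- The hash function `f` does not resolve the query `q` when the positions in `E` are erased,
although at most `t` positions are erased. -/
def HashCollision {M : ℕ} (f : (Fin κ → Fin m) → Fin M) (t : ℕ) (q : Fin κ → Fin m)
    (E : Finset (Fin κ)) : Prop :=
  #E ≤ t ∧ ∃ q', q' ≠ q ∧ channelOutput q' E = channelOutput q E ∧ f q' = f q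

open Classical in
lemma card_hashCollision_le (hm : 1 ≤ m) {M : ℕ} (hM : 0 < M) (t : ℕ) (q : Fin κ → Fin m)
    (E : Finset (Fin κ)) :
    (#{f : (Fin κ → Fin m) → Fin M | HashCollision f t q E} : ℝ)
      ≤ m ^ t / M * Fintype.card ((Fin κ → Fin m) → Fin M) := by
  by_cases hE : #E ≤ t
  · set C : Finset (Fin κ → Fin m) := {q' | channelOutput q' E = channelOutput q E}
    have hsub : ({f : (Fin κ → Fin m) → Fin M | HashCollision f t q E} : Finset _)
        ⊆ (C.erase q).biUnion fun q' => {f | f q' = f q} := by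
      intro f hf
      obtain ⟨-, q', h1, h2, h3⟩ := (mem_filter.1 hf).2
      simp only [mem_biUnion, mem_erase, mem_filter, mem_univ, true_and, C]
      exact ⟨q', ⟨h1, h2⟩, h3⟩
    have hC : #(C.erase q) ≤ m ^ t :=
      (card_le_card (erase_subset _ _)).trans
        ((card_channelOutput_eq_le q E).trans (Nat.pow_le_pow_right hm hE))
    have h : #{f : (Fin κ → Fin m) → Fin M | HashCollision f t q E} * M
        ≤ m ^ t * Fintype.card ((Fin κ → Fin m) → Fin M) := by
      calc _ ≤ (∑ q' ∈ C.erase q, #{f : (Fin κ → Fin m) → Fin M | f q' = f q}) * M :=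
            Nat.mul_le_mul_right _ ((card_le_card hsub).trans card_biUnion_le)
        _ = ∑ q' ∈ C.erase q, #{f : (Fin κ → Fin m) → Fin M | f q' = f q} * M := by
            rw [sum_mul]
        _ ≤ ∑ q' ∈ C.erase q, Fintype.card ((Fin κ → Fin m) → Fin M) :=
            sum_le_sum fun q' hq' => by
              convert card_collision_mul_le (ne_of_mem_erase hq')
        _ ≤ _ := by
            rw [sum_const, smul_eq_mul]
            exact Nat.mul_le_mul_right _ hC
    have hM' : (0 : ℝ) < M := by exact_mod_cast hM
    rw [div_mul_eq_mul_div, le_div_iff₀ hM']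
    exact_mod_cast h
  · have : #{f : (Fin κ → Fin m) → Fin M | HashCollision f t q E} = 0 := by
      rw [card_eq_zero, filter_eq_empty_iff]
      exact fun f _ h => hE h.1
    rw [this]
    push_cast
    positivity

/-- The hash function `f` fails for the query `q` with probability more than `η`. -/
def HashBad {M : ℕ} (ε η : ℝ) (t : ℕ) (f : (Fin κ → Fin m) → Fin M) (q : Fin κ → Fin m) : Prop :=
  η < erasureProb ε (HashCollision f t q)

open Classical in
/-- Averaging over all hash functions: some function is bad for at most a fraction `1 / m` of the
queries in `Q`. -/
lemma exists_hash_few_bad (hε₀ : 0 < ε) (hε₁ : ε < 1) (hm : 1 ≤ m) {M t : ℕ} {η : ℝ} (hη : 0 < η)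
    (hM : (m : ℝ) ^ (t + 1) ≤ η * M) (Q : Finset (Fin κ → Fin m)) :
    ∃ f : (Fin κ → Fin m) → Fin M, #{q ∈ Q | HashBad ε η t f q} * m ≤ #Q := by
  have hm0 : (0 : ℝ) < m := by exact_mod_cast hm
  have hM0' : (0 : ℝ) < M := by
    have : 0 < η * M := (by positivity : (0 : ℝ) < m ^ (t + 1)).trans_le hM
    exact pos_of_mul_pos_right this hη.le
  have hM0 : 0 < M := by exact_mod_cast hM0'
  have : Nonempty (Fin M) := ⟨⟨0, hM0⟩⟩
  have havg : ∑ f : (Fin κ → Fin m) → Fin M, ∑ q ∈ Q, erasureProb ε (HashCollision f t q)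
      ≤ ∑ f : (Fin κ → Fin m) → Fin M, (#Q : ℝ) * (m ^ t / M) := by
    rw [sum_comm, sum_const, nsmul_eq_mul, card_univ]
    have : ∀ q ∈ Q, ∑ f : (Fin κ → Fin m) → Fin M, erasureProb ε (HashCollision f t q)
        ≤ m ^ t / M * Fintype.card ((Fin κ → Fin m) → Fin M) := by
      intro q _
      rw [sum_erasureProb univ fun f E => HashCollision f t q E]
      calc _ ≤ ∑ E : Finset (Fin κ), erasureWeight ε E *
              (m ^ t / M * Fintype.card ((Fin κ → Fin m) → Fin M)) :=
            sum_le_sum fun E _ => mul_le_mul_of_nonneg_left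
              (card_hashCollision_le hm hM0 t q E) (erasureWeight_nonneg hε₀ hε₁ E)
        _ = _ := by rw [← sum_mul, sum_erasureWeight, one_mul]
    refine (sum_le_sum this).trans (le_of_eq ?_)
    rw [sum_const, nsmul_eq_mul]
    ring
  obtain ⟨f, -, hf⟩ := exists_le_of_sum_le univ_nonempty havg
  refine ⟨f, ?_⟩
  have hbad : η * #{q ∈ Q | HashBad ε η t f q} ≤ #Q * (m ^ t / M) := by
    refine le_trans ?_ hf
    calc η * #{q ∈ Q | HashBad ε η t f q} = ∑ q ∈ Q with HashBad ε η t f q, η := by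
          rw [sum_const, nsmul_eq_mul, mul_comm]
      _ ≤ ∑ q ∈ Q with HashBad ε η t f q, erasureProb ε (HashCollision f t q) :=
          sum_le_sum fun q hq => (mem_filter.1 hq).2.le
      _ ≤ _ := by
          refine sum_le_sum_of_subset_of_nonneg (filter_subset _ _) fun q _ _ => ?_
          exact sum_nonneg fun E _ => by
            split_ifs
            exacts [erasureWeight_nonneg hε₀ hε₁ E, le_rfl]
  have h2 : (#{q ∈ Q | HashBad ε η t f q} : ℝ) * m * (η * M) ≤ #Q * (η * M) := by
    calc (#{q ∈ Q | HashBad ε η t f q} : ℝ) * m * (η * M)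
        = η * #{q ∈ Q | HashBad ε η t f q} * (m * M) := by ring
      _ ≤ #Q * (m ^ t / M) * (m * M) := by gcongr
      _ = #Q * m ^ (t + 1) := by
          rw [pow_succ]
          field_simp
      _ ≤ _ := by gcongr
  have := le_of_mul_le_mul_right h2 (by positivity)
  exact_mod_cast this

open Classical in
/-- Greedy choice: all but a fraction `m ^ (-r)` of all queries have a good function among `r` hash
functions. -/
lemma exists_hash_family (hε₀ : 0 < ε) (hε₁ : ε < 1) (hm : 1 ≤ m) {M t : ℕ} {η : ℝ} (hη : 0 < η)
    (hM : (m : ℝ) ^ (t + 1) ≤ η * M) (r : ℕ) :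
    ∃ f : ℕ → (Fin κ → Fin m) → Fin M,
      #{q : Fin κ → Fin m | ∀ i < r, HashBad ε η t (f i) q} * m ^ r ≤ m ^ κ := by
  induction r with
  | zero =>
    obtain ⟨f, -⟩ := exists_hash_few_bad hε₀ hε₁ hm hη hM (∅ : Finset (Fin κ → Fin m))
    exact ⟨fun _ => f, by simp⟩
  | succ r ih =>
    obtain ⟨f, hf⟩ := ih
    obtain ⟨g, hg⟩ := exists_hash_few_bad hε₀ hε₁ hm hη hM
      ({q | ∀ i < r, HashBad ε η t (f i) q} : Finset (Fin κ → Fin m))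
    refine ⟨fun i => if i = r then g else f i, ?_⟩
    have hset : ({q | ∀ i < r + 1, HashBad ε η t (if i = r then g else f i) q} :
        Finset (Fin κ → Fin m)) = ({q | ∀ i < r, HashBad ε η t (f i) q} :
        Finset (Fin κ → Fin m)).filter (HashBad ε η t g) := by
      ext q
      simp only [mem_filter, mem_univ, true_and]
      constructor
      · intro h
        refine ⟨fun i hi => ?_, ?_⟩
        · have := h i (by omega)
          rwa [if_neg hi.ne] at this
        · have := h r (by omega)
          rwa [if_pos rfl] at this
      · rintro ⟨h1, h2⟩ i hi
        split_ifs with hir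
        · exact h2
        · exact h1 i (by omega)
    rw [hset, pow_succ, mul_comm (m ^ r) m, ← mul_assoc]
    exact (Nat.mul_le_mul_right _ hg).trans hf

/-- Achievability: with `κ + 1` greedily chosen hash functions to `M` values, every query has a good
one; the cache holds its index and the hash value. -/
lemma exists_codedScheme (hε₀ : 0 < ε) (hε₁ : ε < 1) (hm : 2 ≤ m) {M t σ : ℕ} {η : ℝ} (hη : 0 < η)
    (hM : (m : ℝ) ^ (t + 1) ≤ η * M) (hσ : (κ + 1) * M ≤ 2 ^ σ)
    (hδ : erasureProb ε (fun E : Finset (Fin κ) => t < #E) + η ≤ δ) (Q : Set (Fin κ → Fin m)) :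
    ∃ s : CodedScheme m κ σ, s.IsReliable Q ε δ := by
  classical
  obtain ⟨f, hf⟩ := exists_hash_family (κ := κ) hε₀ hε₁ (by omega : 1 ≤ m) hη hM (κ + 1)
  have hgood : ∀ q : Fin κ → Fin m, ∃ i : Fin (κ + 1), ¬ HashBad ε η t (f i) q := by
    by_contra! hcon
    obtain ⟨q, hq⟩ := hcon
    have h1 : 0 < #{q : Fin κ → Fin m | ∀ i < κ + 1, HashBad ε η t (f i) q} :=
      card_pos.2 ⟨q, by simpa using fun i hi => hq ⟨i, hi⟩⟩
    have h2 : m ^ κ < m ^ (κ + 1) := Nat.pow_lt_pow_right (by omega) (by omega)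
    have h3 := Nat.mul_le_mul_right (m ^ (κ + 1)) h1
    omega
  choose i hi using hgood
  refine exists_codedScheme_of_enc (β := Fin (κ + 1) × Fin M) (by simpa using hσ)
    (fun q => (i q, f (i q) q)) (fun q _ => ?_) hε₀ hε₁
  have hfail : erasureProb ε (fun E => ¬ ∀ q', channelOutput q' E = channelOutput q E →
      (i q', f (i q') q') = (i q, f (i q) q) → q' = q) ≤ δ := by
    refine le_trans (erasureProb_mono hε₀ hε₁ (Q := fun E => t < #E ∨ HashCollision (f (i q)) t q E)
      fun E hE => ?_) ((erasureProb_or_le hε₀ hε₁ _ _).trans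
        ((add_le_add_right (not_lt.1 (hi q)) _).trans hδ))
    rcases lt_or_ge t #E with h | h
    · exact Or.inl h
    · push Not at hE
      obtain ⟨q', h1, h2, h3⟩ := hE
      have h4 := congrArg Prod.fst h2
      have h5 := congrArg Prod.snd h2
      simp only at h4 h5
      rw [h4] at h5
      exact Or.inr ⟨h, q', h3, h1, h5⟩
  rw [erasureProb_not] at hfail
  linarith

/-! ### Coded caching: converse by counting -/

open Classical in
/-- Converse: from at most `κ - t` received symbols and `σ` bits, at most `2 ^ σ m ^ (κ - t)`
queries are decoded. -/
lemma card_mul_one_sub_le_of_isReliable (hε₀ : 0 < ε) (hε₁ : ε < 1) (hm : 1 ≤ m) {σ : ℕ}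
    (s : CodedScheme m κ σ) (Q : Finset (Fin κ → Fin m)) (hs : s.IsReliable (Q : Set _) ε δ)
    (t : ℕ) :
    #Q * (1 - δ) ≤ #Q * erasureProb ε (fun E : Finset (Fin κ) => #E < t)
      + 2 ^ σ * m ^ κ / m ^ t := by
  have hm0 : (0 : ℝ) < m := by exact_mod_cast hm
  obtain ⟨P, hP⟩ : ∃ P : (Fin κ → Fin m) → Finset (Fin κ) → Prop,
      ∀ q E, P q E ↔ s.dec (channelOutput q E) (s.enc q) = some q := ⟨_, fun _ _ => Iff.rfl⟩
  have hcount : ∀ E : Finset (Fin κ),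
      #{q ∈ Q | P q E} ≤ m ^ (κ - #E) * 2 ^ σ := by
    intro E
    have h : #{q ∈ Q | P q E}
        ≤ #(univ : Finset (((Eᶜ : Finset (Fin κ)) → Fin m) × (Fin σ → Bool))) := by
      refine card_le_card_of_injOn (fun q => (fun j => q j, s.enc q)) (fun _ _ => by simp) ?_
      intro x hx y hy hxy
      have hx' := (hP x E).1 (mem_filter.1 hx).2
      have hy' := (hP y E).1 (mem_filter.1 hy).2
      have h1 : channelOutput x E = channelOutput y E := by
        funext j
        by_cases hj : j ∈ E
        · simp [channelOutput, hj]
        · have := congrFun (congrArg Prod.fst hxy) ⟨j, mem_compl.2 hj⟩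
          simpa [channelOutput, hj] using this
      have h2 : s.enc x = s.enc y := congrArg Prod.snd hxy
      rw [h1, h2, hy'] at hx'
      exact (Option.some.inj hx').symm
    refine h.trans (le_of_eq ?_)
    simp
  have hsum : (#Q : ℝ) * (1 - δ)
      ≤ ∑ q ∈ Q, erasureProb ε (P q) := by
    rw [← nsmul_eq_mul, ← sum_const]
    exact sum_le_sum fun q hq =>
      (hs q hq).trans (erasureProb_mono hε₀ hε₁ fun E => (hP q E).2)
  refine hsum.trans ?_
  rw [sum_erasureProb]
  calc _ ≤ ∑ E : Finset (Fin κ), (#Q * (if #E < t then erasureWeight ε E else 0)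
          + erasureWeight ε E * (2 ^ σ * m ^ κ / m ^ t)) := by
        refine sum_le_sum fun E _ => ?_
        have hw := erasureWeight_nonneg hε₀ hε₁ E
        have hpos : (0 : ℝ) ≤ 2 ^ σ * m ^ κ / m ^ t := by positivity
        split_ifs with hE
        · have h1 : (#{q ∈ Q | P q E} : ℝ) ≤ #Q := by
            exact_mod_cast card_filter_le _ _
          have h2 := mul_le_mul_of_nonneg_left h1 hw
          have h3 := mul_nonneg hw hpos
          rw [mul_comm (#Q : ℝ)]
          linarith
        · rw [mul_zero, zero_add]
          refine mul_le_mul_of_nonneg_left ?_ hw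
          rw [le_div_iff₀ (by positivity)]
          have h1 : m ^ (κ - #E) * m ^ t ≤ m ^ κ := by
            have : #E ≤ κ := by simpa using card_le_univ E
            rw [← pow_add]
            exact Nat.pow_le_pow_right hm (by omega)
          have h2 : #{q ∈ Q | P q E} * m ^ t
              ≤ 2 ^ σ * m ^ κ := by
            calc _ ≤ m ^ (κ - #E) * 2 ^ σ * m ^ t := Nat.mul_le_mul_right _ (hcount E)
              _ = 2 ^ σ * (m ^ (κ - #E) * m ^ t) := by ring
              _ ≤ _ := Nat.mul_le_mul_left _ h1
          exact_mod_cast h2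
    _ = _ := by
        rw [sum_add_distrib, ← mul_sum, ← sum_mul, sum_erasureWeight, one_mul]
        congr 2
        exact sum_congr rfl fun E _ => by by_cases hE : #E < t <;> simp [hE]

end

end Dispersion

namespace Dispersion

open Finset

/-! ### The dispersion of coded caching -/

lemma one_le_logb {m : ℕ} (hm : 2 ≤ m) : 1 ≤ Real.logb 2 m := by
  have : (2 : ℝ) ≤ m := by exact_mod_cast hm
  rw [Real.le_logb_iff_rpow_le one_lt_two (by linarith), Real.rpow_one]
  exact this

lemma clog_le_logb_add_one {n : ℕ} (hn : 1 ≤ n) : (Nat.clog 2 n : ℝ) ≤ Real.logb 2 n + 1 := by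
  have h1 : (1 : ℝ) ≤ n := by exact_mod_cast hn
  have h := Real.natCeil_logb_natCast 2 n
  rw [Nat.cast_ofNat] at h
  rw [← h]
  exact (Nat.ceil_lt_add_one (Real.logb_nonneg one_lt_two h1)).le

lemma sqrt_mul_mul_logb_sq (κ m : ℕ) (v : ℝ) (hv : 0 ≤ v) :
    √(κ * (v * Real.logb 2 m ^ 2)) = √(κ * v) * Real.logb 2 m := by
  have hL : 0 ≤ Real.logb 2 m := by
    rcases Nat.eq_zero_or_pos m with h | h
    · simp [h]
    · exact Real.logb_nonneg one_lt_two (by exact_mod_cast h)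
  rw [← mul_assoc, Real.sqrt_mul (by positivity), Real.sqrt_sq hL]

section

variable {ε δ : ℝ}

lemma minCodedCache_le (hε₀ : 0 < ε) (hε₁ : ε < 1) (hδ₀ : 0 < δ) (hδ₁ : δ < 1) :
    ∃ C : ℝ, ∀ m κ : ℕ, 2 ≤ m → 1 ≤ κ → κ ≤ m → ∀ Q : Set (Fin κ → Fin m),
      {σ : ℕ | ∃ s : CodedScheme m κ σ, s.IsReliable Q ε δ}.Nonempty ∧
      (minCodedCache Q ε δ : ℝ) ≤ (κ * ε + √(κ * (ε * (1 - ε))) * normalQuantile (1 - δ))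
        * Real.logb 2 m + C * Real.logb 2 m := by
  obtain ⟨K, hK⟩ := exists_erasures_upper_quantile hε₀ hε₁ hδ₀ hδ₁
  have hlδ : 0 ≤ Real.logb 2 (8 / δ) := Real.logb_nonneg one_lt_two (by
    rw [le_div_iff₀ hδ₀]; linarith)
  refine ⟨K + 4 + Real.logb 2 (8 / δ), fun m κ hm hκ hκm Q => ?_⟩
  obtain ⟨t, ht, hprob⟩ := hK κ hκ
  have hm2 : (2 : ℝ) ≤ m := by exact_mod_cast hm
  have hκ1 : (1 : ℝ) ≤ κ := by exact_mod_cast hκ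
  have hκm' : (κ : ℝ) ≤ m := by exact_mod_cast hκm
  have hL := one_le_logb hm
  set L := Real.logb 2 m with hLdef
  -- the margin of the quantile is spent on hash collisions
  set η := δ / (2 * κ) with hη
  have hη0 : 0 < η := by positivity
  set M := ⌈(m : ℝ) ^ (t + 1) / η⌉₊ with hM
  have hM1 : (m : ℝ) ^ (t + 1) ≤ η * M := by
    rw [mul_comm, ← div_le_iff₀ hη0]
    exact Nat.le_ceil _
  have hmt : (1 : ℝ) ≤ m ^ (t + 1) := one_le_pow₀ (by linarith)
  have hM2 : (M : ℝ) ≤ m ^ (t + 1) * (4 * m / δ) := by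
    have h1 := (Nat.ceil_lt_add_one (show 0 ≤ (m : ℝ) ^ (t + 1) / η by positivity)).le
    have h2 : (m : ℝ) ^ (t + 1) / η ≤ m ^ (t + 1) * (2 * m / δ) := by
      rw [hη, div_div_eq_mul_div, mul_div_assoc]
      gcongr
    have h3 : (1 : ℝ) ≤ m ^ (t + 1) * (2 * m / δ) := by
      refine one_le_mul_of_one_le_of_one_le hmt ?_
      rw [le_div_iff₀ hδ₀]
      linarith
    have h4 : (m : ℝ) ^ (t + 1) * (4 * m / δ)
        = m ^ (t + 1) * (2 * m / δ) + m ^ (t + 1) * (2 * m / δ) := by ring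
    linarith
  have hM0 : 0 < M := Nat.ceil_pos.2 (by positivity)
  obtain ⟨s, hs⟩ := exists_codedScheme (κ := κ) (δ := δ) hε₀ hε₁ hm hη0 hM1
    (Nat.le_pow_clog one_lt_two ((κ + 1) * M)) (by linarith) Q
  refine ⟨⟨_, s, hs⟩, ?_⟩
  have hmin : minCodedCache Q ε δ ≤ Nat.clog 2 ((κ + 1) * M) := Nat.sInf_le ⟨s, hs⟩
  have hmin' : (minCodedCache Q ε δ : ℝ) ≤ Nat.clog 2 ((κ + 1) * M) := by exact_mod_cast hmin
  have hclog := clog_le_logb_add_one (n := (κ + 1) * M) (Nat.mul_pos (by omega) hM0)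
  have hlog : Real.logb 2 (((κ + 1) * M : ℕ) : ℝ) ≤ (t + 3) * L + Real.logb 2 (8 / δ) := by
    have hM0' : (0 : ℝ) < M := by exact_mod_cast hM0
    have h1 : (((κ + 1) * M : ℕ) : ℝ) ≤ m ^ (t + 3) * (8 / δ) := by
      push_cast
      calc ((κ : ℝ) + 1) * M ≤ (2 * m) * (m ^ (t + 1) * (4 * m / δ)) := by
            gcongr
            linarith
        _ = _ := by ring
    refine (Real.logb_le_logb_of_le one_lt_two (by push_cast; positivity) h1).trans (le_of_eq ?_)
    rw [Real.logb_mul (by positivity) (by positivity), Real.logb_pow]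
    push_cast
    rfl
  have h5 := mul_le_mul_of_nonneg_right ht (by linarith : 0 ≤ L)
  have h6 := mul_le_mul_of_nonneg_left hL hlδ
  linarith

lemma le_minCodedCache (hε₀ : 0 < ε) (hε₁ : ε < 1) (hδ₀ : 0 < δ) (hδ₁ : δ < 1) (c : ℕ) :
    ∃ C : ℝ, ∀ m κ : ℕ, 2 ≤ m → 1 ≤ κ → κ ≤ m → ∀ Q : Set (Fin κ → Fin m),
      m ^ κ ≤ m ^ c * Q.ncard →
      (κ * ε + √(κ * (ε * (1 - ε))) * normalQuantile (1 - δ)) * Real.logb 2 m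
        - C * Real.logb 2 m ≤ minCodedCache Q ε δ := by
  obtain ⟨K, hK⟩ := exists_erasures_lower_quantile hε₀ hε₁ hδ₀ hδ₁
  obtain ⟨C', hC'⟩ := minCodedCache_le hε₀ hε₁ hδ₀ hδ₁
  have h1δ : 0 < 1 - δ := by linarith
  have hlδ : Real.logb 2 (1 - δ) ≤ 0 := Real.logb_nonpos one_lt_two h1δ.le (by linarith)
  refine ⟨K + c + 1 - Real.logb 2 (1 - δ), fun m κ hm hκ hκm Q hQ => ?_⟩
  classical
  obtain ⟨t, ht, hprob⟩ := hK κ hκ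
  have hm2 : (2 : ℝ) ≤ m := by exact_mod_cast hm
  have hm0 : (0 : ℝ) < m := by linarith
  have hκ1 : (1 : ℝ) ≤ κ := by exact_mod_cast hκ
  have hκm' : (κ : ℝ) ≤ m := by exact_mod_cast hκm
  have hL := one_le_logb hm
  obtain ⟨s, hs⟩ : minCodedCache Q ε δ ∈
      {σ : ℕ | ∃ s : CodedScheme m κ σ, s.IsReliable Q ε δ} :=
    Nat.sInf_mem (hC' m κ hm hκ hκm Q).1
  generalize minCodedCache Q ε δ = σ at s hs ⊢
  set L := Real.logb 2 m with hLdef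
  have hconv := card_mul_one_sub_le_of_isReliable hε₀ hε₁ (δ := δ) (by omega : 1 ≤ m) s Q.toFinset
    (by simpa using hs) t
  rw [← Set.ncard_eq_toFinset_card'] at hconv
  have hQ' : (m : ℝ) ^ κ ≤ m ^ c * Q.ncard := by exact_mod_cast hQ
  have hN0 : (0 : ℝ) < Q.ncard := by
    have : (0 : ℝ) < m ^ c * Q.ncard := (by positivity : (0 : ℝ) < m ^ κ).trans_le hQ'
    exact pos_of_mul_pos_right this (by positivity)
  -- the margin `(1 - δ) / κ` of the quantile turns the converse into a lower bound on `2 ^ σ`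
  have hmain : (m : ℝ) ^ t * (1 - δ) ≤ 2 ^ σ * m ^ (c + 1) := by
    have h1 : (Q.ncard : ℝ) * ((1 - δ) / κ) ≤ 2 ^ σ * m ^ κ / m ^ t := by
      have := mul_le_mul_of_nonneg_left hprob hN0.le
      linarith
    have h2 : (2 : ℝ) ^ σ * m ^ κ / m ^ t ≤ 2 ^ σ * (m ^ c * Q.ncard) / m ^ t := by gcongr
    have h3 : (Q.ncard : ℝ) * ((1 - δ) / κ) ≤ Q.ncard * (2 ^ σ * m ^ c / m ^ t) := by
      refine (h1.trans h2).trans (le_of_eq ?_)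
      ring
    have h4 := le_of_mul_le_mul_left h3 hN0
    rw [div_le_div_iff₀ (by linarith) (by positivity)] at h4
    calc (m : ℝ) ^ t * (1 - δ) = (1 - δ) * m ^ t := mul_comm _ _
      _ ≤ 2 ^ σ * m ^ c * κ := h4
      _ ≤ 2 ^ σ * m ^ c * m := by gcongr
      _ = _ := by ring
  have hlog := Real.logb_le_logb_of_le one_lt_two (by positivity) hmain
  rw [Real.logb_mul (by positivity) h1δ.ne', Real.logb_mul (by positivity) (by positivity),
    Real.logb_pow, Real.logb_pow, Real.logb_pow, Real.logb_self_eq_one one_lt_two] at hlog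
  push_cast at hlog
  have h5 := mul_le_mul_of_nonneg_right ht (by linarith : 0 ≤ L)
  have h6 := mul_le_mul_of_nonneg_left hL (neg_nonneg.2 hlδ)
  linarith

/-- Coded caching has dispersion `ε (1 - ε) (log m)²` for every family that contains all tuples up
to a factor polynomial in `m`. -/
lemma hasDispersion_minCodedCache (hε₀ : 0 < ε) (hε₁ : ε < 1) (hδ₀ : 0 < δ) (hδ₁ : δ < 1)
    {I : Set (ℕ × ℕ)} (hI : ∀ p ∈ I, 2 ≤ p.1 ∧ 1 ≤ p.2 ∧ p.2 ≤ p.1)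
    (Q : ∀ p : ℕ × ℕ, Set (Fin p.2 → Fin p.1)) (c : ℕ)
    (hQ : ∀ p ∈ I, p.1 ^ p.2 ≤ p.1 ^ c * (Q p).ncard) :
    HasDispersion δ I (fun p => p.1) (fun p => p.2) (fun p => (minCodedCache (Q p) ε δ : ℝ))
      (fun m => ε * Real.logb 2 m) (cacheDispersion ε) := by
  have hv : 0 ≤ ε * (1 - ε) := mul_nonneg hε₀.le (by linarith)
  refine ⟨fun n => mul_nonneg hv (sq_nonneg _), ?_⟩
  obtain ⟨C₁, h₁⟩ := minCodedCache_le hε₀ hε₁ hδ₀ hδ₁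
  obtain ⟨C₂, h₂⟩ := le_minCodedCache hε₀ hε₁ hδ₀ hδ₁ c
  refine ⟨max C₁ C₂, fun p hp => ?_⟩
  obtain ⟨hm, hκ, hκm⟩ := hI p hp
  have hL := one_le_logb hm
  have hu := (h₁ p.1 p.2 hm hκ hκm (Q p)).2
  have hl := h₂ p.1 p.2 hm hκ hκm (Q p) (hQ p hp)
  have e1 := mul_le_mul_of_nonneg_right (le_max_left C₁ C₂) (by linarith : 0 ≤ Real.logb 2 p.1)
  have e2 := mul_le_mul_of_nonneg_right (le_max_right C₁ C₂) (by linarith : 0 ≤ Real.logb 2 p.1)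
  simp only [cacheDispersion]
  rw [sqrt_mul_mul_logb_sq _ _ _ hv, abs_le]
  constructor <;> linarith

end

/-- On the range `κ² ≤ A m` the tuples with distinct coordinates make up a fraction of all tuples
that is bounded below by a power of `m`. -/
lemma pow_le_mul_ncard_distinctTuples {m κ A : ℕ} (hm : 2 ≤ m) (hκm : κ ≤ m)
    (hA : κ ^ 2 ≤ A * m) : m ^ κ ≤ m ^ (4 * A) * (distinctTuples m κ).ncard := by
  have hcard : (distinctTuples m κ).ncard = m.descFactorial κ := by
    rw [← Nat.card_coe_set_eq]
    refine (Nat.card_congr (Equiv.subtypeInjectiveEquivEmbedding (Fin κ) (Fin m))).trans ?_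
    rw [Nat.card_eq_fintype_card, Fintype.card_embedding_eq, Fintype.card_fin, Fintype.card_fin]
  rw [hcard]
  rcases lt_or_ge m (2 * κ) with h | h
  · -- here `m < 4 A`, so that `κ ≤ 4 A`
    have hκ : κ ≤ 4 * A := by nlinarith
    exact (Nat.pow_le_pow_right (by omega) hκ).trans
      (Nat.le_mul_of_pos_right _ (Nat.descFactorial_pos.2 hκm))
  · have hm0 : (0 : ℝ) < m := by exact_mod_cast (by omega : 0 < m)
    have h' : (2 * κ : ℝ) ≤ m := by exact_mod_cast h
    have hA' : (κ : ℝ) ^ 2 ≤ A * m := by exact_mod_cast hA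
    have hκ0 : (0 : ℝ) ≤ κ := Nat.cast_nonneg κ
    have h1 : (m : ℝ) ≤ (m - κ) * (1 + 2 * κ / m) := by
      have e : ((m : ℝ) - κ) * (1 + 2 * κ / m) = m + κ * (m - 2 * κ) / m := by
        field_simp
        ring
      have : 0 ≤ κ * (m - 2 * κ) / (m : ℝ) :=
        div_nonneg (mul_nonneg hκ0 (by linarith)) hm0.le
      linarith
    have h2 : (1 + 2 * κ / m : ℝ) ^ κ ≤ m ^ (4 * A) := by
      calc (1 + 2 * κ / m : ℝ) ^ κ ≤ (Real.exp (2 * κ / m)) ^ κ := by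
            gcongr
            linarith [Real.add_one_le_exp (2 * κ / m : ℝ)]
        _ = Real.exp (2 * κ ^ 2 / m) := by
            rw [← Real.exp_nat_mul]
            ring_nf
        _ ≤ Real.exp ((2 * A : ℕ) * 1) := by
            apply Real.exp_le_exp.2
            rw [div_le_iff₀ hm0]
            push_cast
            linarith
        _ = Real.exp 1 ^ (2 * A) := Real.exp_nat_mul _ _
        _ ≤ (m ^ 2) ^ (2 * A) := by
            have h3 := Real.exp_one_lt_d9
            have h4 : (2 : ℝ) ≤ m := by exact_mod_cast hm
            gcongr
            nlinarith
        _ = m ^ (4 * A) := by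
            rw [← pow_mul]
            ring_nf
    have h5 : ((m - κ : ℕ) : ℝ) ^ κ ≤ m.descFactorial κ := by
      exact_mod_cast (Nat.pow_le_pow_left (by omega) κ).trans (Nat.pow_sub_le_descFactorial m κ)
    rw [Nat.cast_sub hκm] at h5
    have h6 : (m : ℝ) ^ κ ≤ m ^ (4 * A) * m.descFactorial κ := by
      calc (m : ℝ) ^ κ ≤ ((m - κ) * (1 + 2 * κ / m)) ^ κ := by gcongr
        _ = (1 + 2 * κ / m) ^ κ * (m - κ) ^ κ := by rw [mul_pow, mul_comm]
        _ ≤ _ := by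
            have : (0 : ℝ) ≤ m - κ := by linarith
            gcongr
    exact_mod_cast h6

/-! ### Uniqueness of the dispersion -/

lemma normalQuantile_ne_zero {δ : ℝ} (hδ₀ : 0 < δ) (hδ₁ : δ < 1) (hδ : δ ≠ 1 / 2) :
    normalQuantile (1 - δ) ≠ 0 := by
  intro h
  have := normalCDF_normalQuantile (p := 1 - δ) (by linarith) (by linarith)
  rw [h, normalCDF_zero] at this
  exact hδ (by linarith)

/-- A minimum cache has at most one dispersion of the form `v (log m)²` when the quantile does not
vanish and `κ` is unbounded. -/
lemma HasDispersion.coeff_unique {δ : ℝ} {I : Set (ℕ × ℕ)} {m κ : ℕ × ℕ → ℕ} {σ : ℕ × ℕ → ℝ}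
    {R : ℕ → ℝ} {v w : ℝ} (hq : normalQuantile (1 - δ) ≠ 0)
    (h₁ : HasDispersion δ I m κ σ R (fun m => v * Real.logb 2 m ^ 2))
    (h₂ : HasDispersion δ I m κ σ R (fun m => w * Real.logb 2 m ^ 2))
    (hI : ∀ n : ℕ, ∃ p ∈ I, 2 ≤ m p ∧ n ≤ κ p) : v = w := by
  obtain ⟨hv, C₁, h₁⟩ := h₁
  obtain ⟨hw, C₂, h₂⟩ := h₂
  have hv0 : 0 ≤ v := by simpa using hv 2
  have hw0 : 0 ≤ w := by simpa using hw 2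
  by_contra hne
  have hsq : √v - √w ≠ 0 := fun h => hne ((Real.sqrt_inj hv0 hw0).1 (sub_eq_zero.1 h))
  set D := |(√v - √w) * normalQuantile (1 - δ)| with hD
  have hD0 : 0 < D := abs_pos.2 (mul_ne_zero hsq hq)
  obtain ⟨n, hn⟩ := exists_nat_gt (((C₁ + C₂) / D) ^ 2)
  obtain ⟨p, hp, hm, hκ⟩ := hI n
  have hL := one_le_logb hm
  have hb₁ := abs_le.1 (h₁ p hp)
  have hb₂ := abs_le.1 (h₂ p hp)
  simp only [sqrt_mul_mul_logb_sq _ _ _ hv0, sqrt_mul_mul_logb_sq _ _ _ hw0,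
    Real.sqrt_mul (Nat.cast_nonneg _)] at hb₁ hb₂
  set L := Real.logb 2 (m p)
  have h3 : √(κ p) * D * L ≤ (C₁ + C₂) * L := by
    have e : √(κ p) * D * L = |√(κ p) * √v * L * normalQuantile (1 - δ)
        - √(κ p) * √w * L * normalQuantile (1 - δ)| := by
      have e' : √(κ p) * √v * L * normalQuantile (1 - δ) - √(κ p) * √w * L * normalQuantile (1 - δ)
          = √(κ p) * ((√v - √w) * normalQuantile (1 - δ)) * L := by ring
      rw [e', abs_mul, abs_mul, abs_of_nonneg (Real.sqrt_nonneg _),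
        abs_of_nonneg (by linarith : 0 ≤ L)]
    rw [e, abs_le]
    constructor <;> linarith [hb₁.1, hb₁.2, hb₂.1, hb₂.2]
  have h4 := le_of_mul_le_mul_right h3 (by linarith)
  rw [← le_div_iff₀ hD0] at h4
  have h5 : ((C₁ + C₂) / D) ^ 2 < κ p := hn.trans_le (by exact_mod_cast hκ)
  have h6 : (κ p : ℝ) ≤ ((C₁ + C₂) / D) ^ 2 := by
    rw [← Real.sq_sqrt (Nat.cast_nonneg (α := ℝ) (κ p))]
    exact pow_le_pow_left₀ (Real.sqrt_nonneg _) h4 2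
  linarith

end Dispersion

namespace Dispersion

open Finset

/-! ### Derivations and coordinates -/

/-- The coordinates of a fact. -/
def Fact.coords {m : ℕ} : Fact m → List (Fin m)
  | .base i => [i]
  | .derived _ x => x

lemma Fact.length_coords {m : ℕ} (f : Fact m) : f.coords.length = f.arity := by
  cases f <;> rfl

section

variable {m k : ℕ}

/-- No rule invents coordinates. -/
lemma Architecture.exists_mem_coords {arch : Architecture} {body : List (Fact m)} {f : Fact m}
    (h : arch.rules m k body f) {i : Fin m} (hi : i ∈ f.coords) : ∃ b ∈ body, i ∈ b.coords := by
  cases arch with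
  | chain =>
    cases h with
    | init x hx => exact ⟨.base i, List.mem_map_of_mem hi, by simp [Fact.coords]⟩
    | extend n x j hn hx =>
      rcases List.mem_append.1 hi with h | h
      · exact ⟨.derived n x, by simp, h⟩
      · exact ⟨.base j, by simp, h⟩
  | merge =>
    cases h with
    | init x hx => exact ⟨.base i, List.mem_map_of_mem hi, by simp [Fact.coords]⟩
    | merge d x y hd hx hy =>
      rcases List.mem_append.1 hi with h | h
      · exact ⟨.derived d x, by simp, h⟩
      · exact ⟨.derived d y, by simp, h⟩

/-- A coordinate of a derivable fact survives or is a coordinate of a cached fact. -/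
lemma Architecture.not_mem_or_exists_of_cn {arch : Architecture} {E : Finset (Fin m)}
    {S : Set (Fact m)} {f : Fact m} (h : Cn (arch.rules m k) (survivingBase E ∪ S) f) :
    ∀ i ∈ f.coords, i ∉ E ∨ ∃ g ∈ S, i ∈ g.coords := by
  induction h with
  | premise f hf =>
    intro i hi
    rcases hf with ⟨j, hj, rfl⟩ | hf
    · rw [Fact.coords, List.mem_singleton] at hi
      exact Or.inl (hi ▸ hj)
    · exact Or.inr ⟨f, hf, hi⟩
  | step body f hr hb ih =>
    intro i hi
    obtain ⟨b, hb', hib⟩ := Architecture.exists_mem_coords hr hi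
    exact ih b hb' i hib

lemma Architecture.coords_query (arch : Architecture) (k d : ℕ)
    (x : Fin (arch.arity k d) → Fin m) : (arch.query k d x).coords = List.ofFn x := by
  cases arch <;> rfl

/-! ### The derivation-constrained converse -/

lemma le_resilienceThreshold_iff {ε δ : ℝ} (hε₀ : 0 < ε) (hε₁ : ε < 1) (hδ₀ : 0 < δ) (hδ₁ : δ < 1)
    (n : ℕ) : n ≤ resilienceThreshold ε δ ↔ 1 - δ ≤ (1 - ε) ^ n := by
  have h1ε : 0 < 1 - ε := by linarith
  have h1δ : 0 < 1 - δ := by linarith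
  have hlε : 0 < Real.log (1 / (1 - ε)) := Real.log_pos (by
    rw [lt_div_iff₀ h1ε]; linarith)
  have hlδ : 0 < Real.log (1 / (1 - δ)) := Real.log_pos (by
    rw [lt_div_iff₀ h1δ]; linarith)
  rw [resilienceThreshold, Nat.le_floor_iff (by positivity), le_div_iff₀ hlε, one_div, one_div,
    Real.log_inv, Real.log_inv, mul_neg, neg_le_neg_iff, ← Real.log_pow,
    Real.log_le_log_iff h1δ (by positivity)]

lemma arity_mul_logb_le_clog (m a : ℕ) :
    a * Real.logb 2 m ≤ Nat.clog 2 (m ^ a) := by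
  have h := Real.natCeil_logb_natCast 2 (m ^ a)
  rw [Nat.cast_ofNat] at h
  rw [← h, ← Real.logb_pow]
  push_cast
  exact Nat.le_ceil _

/-- Converse: all but at most `N*` of the coordinates of the query are coordinates of cached facts,
since the remaining ones all have to survive. -/
lemma le_of_isDerivationScheme {arch : Architecture} {d : ℕ} {ε δ : ℝ} (hε₀ : 0 < ε) (hε₁ : ε < 1)
    (hδ₀ : 0 < δ) (hδ₁ : δ < 1) (hm : 1 ≤ m) (hκ : arch.arity k d ≤ m) {σ : ℕ}
    {S : (Fin (arch.arity k d) → Fin m) → Finset (Fact m)}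
    (h : IsDerivationScheme arch k d m ε δ σ S) :
    ((arch.arity k d : ℝ) - resilienceThreshold ε δ) * Real.logb 2 m ≤ σ := by
  classical
  obtain ⟨-, hσ, hprob⟩ := h (Fin.castLE hκ) (Fin.castLE_injective hκ)
  set x : Fin (arch.arity k d) → Fin m := Fin.castLE hκ
  set cov : Finset (Fin m) := (S x).biUnion fun f => f.coords.toFinset
  set U : Finset (Fin m) := univ.image x \ cov
  have hU : 1 - δ ≤ (1 - ε) ^ #U := by
    rw [← erasureProb_disjoint]
    refine hprob.trans (erasureProb_mono hε₀ hε₁ fun E hE i hi => ?_)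
    obtain ⟨hi1, hi2⟩ := mem_sdiff.1 hi
    obtain ⟨j, -, hj⟩ := mem_image.1 hi1
    have hmem : i ∈ (arch.query k d x).coords := by
      rw [Architecture.coords_query, List.mem_ofFn]
      exact ⟨j, hj⟩
    rcases Architecture.not_mem_or_exists_of_cn hE i hmem with h | ⟨g, hg, hig⟩
    · exact h
    · exact absurd (mem_biUnion.2 ⟨g, hg, List.mem_toFinset.2 hig⟩) hi2
  have hUN := (le_resilienceThreshold_iff hε₀ hε₁ hδ₀ hδ₁ _).2 hU
  have hcov : #cov ≤ ∑ f ∈ S x, f.arity :=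
    card_biUnion_le.trans (sum_le_sum fun f _ =>
      (List.toFinset_card_le _).trans (Fact.length_coords f).le)
  have hκ' : arch.arity k d ≤ resilienceThreshold ε δ + ∑ f ∈ S x, f.arity := by
    have h1 : #(univ.image x) = arch.arity k d := by
      rw [card_image_of_injective _ (Fin.castLE_injective hκ), card_univ, Fintype.card_fin]
    have h2 : #(univ.image x) ≤ #U + #cov := card_le_card_sdiff_add_card
    rw [h1] at h2
    exact h2.trans (add_le_add hUN hcov)
  have hκ'' : (arch.arity k d : ℝ) - resilienceThreshold ε δ ≤ ∑ f ∈ S x, (f.arity : ℝ) := by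
    rw [sub_le_iff_le_add']
    exact_mod_cast hκ'
  have hL : 0 ≤ Real.logb 2 m := Real.logb_nonneg one_lt_two (by exact_mod_cast hm)
  calc _ ≤ (∑ f ∈ S x, (f.arity : ℝ)) * Real.logb 2 m := mul_le_mul_of_nonneg_right hκ'' hL
    _ = ∑ f ∈ S x, f.arity * Real.logb 2 m := sum_mul _ _ _
    _ ≤ ∑ f ∈ S x, (Nat.clog 2 (m ^ f.arity) : ℝ) :=
        sum_le_sum fun f _ => arity_mul_logb_le_clog m _
    _ = (storageBits (S x) : ℝ) := by
        rw [storageBits]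
        push_cast
        rfl
    _ ≤ σ := by exact_mod_cast hσ

/-! ### Derivation-constrained achievability -/

/-- At most `B` derivable facts, with `n` coordinates in total, from which the fact `q` is derivable
together with the base facts of the entries of `x` after the first `n`. -/
def HasPrefixCover (rules : List (Fact m) → Fact m → Prop) (x : List (Fin m)) (q : Fact m)
    (n B : ℕ) : Prop :=
  ∃ F : Finset (Fact m), (∀ f ∈ F, Cn rules (premiseBase m) f) ∧ ∑ f ∈ F, f.arity ≤ n ∧ #F ≤ B ∧
    ∀ Γ : Set (Fact m), (∀ i ∈ x.drop n, Cn rules Γ (.base i)) → (∀ f ∈ F, Cn rules Γ f) →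
      Cn rules Γ q

lemma cn_premiseBase (rules : List (Fact m) → Fact m → Prop) (i : Fin m) :
    Cn rules (premiseBase m) (.base i) :=
  .premise _ ⟨i, rfl⟩

/-- A prefix of length `n` is covered by its `n` base facts. -/
lemma hasPrefixCover_of_base {rules : List (Fact m) → Fact m → Prop} {x : List (Fin m)}
    {q : Fact m} {n : ℕ}
    (h : ∀ Γ : Set (Fact m), (∀ i ∈ x, Cn rules Γ (.base i)) → Cn rules Γ q) :
    HasPrefixCover rules x q n n := by
  classical
  have hcard : #(((x.take n).map Fact.base).toFinset) ≤ n := by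
    refine (List.toFinset_card_le _).trans ?_
    simp
  refine ⟨((x.take n).map Fact.base).toFinset, fun f hf => ?_, ?_, hcard, fun Γ hΓ hF => ?_⟩
  · obtain ⟨i, -, rfl⟩ := List.mem_map.1 (List.mem_toFinset.1 hf)
    exact cn_premiseBase _ i
  · have : ∀ f ∈ ((x.take n).map Fact.base).toFinset, f.arity = 1 := by
      intro f hf
      obtain ⟨i, -, rfl⟩ := List.mem_map.1 (List.mem_toFinset.1 hf)
      rfl
    rw [sum_congr rfl this, sum_const, smul_eq_mul, mul_one]
    exact hcard
  · refine h Γ fun i hi => ?_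
    rw [← List.take_append_drop n x] at hi
    rcases List.mem_append.1 hi with h | h
    · exact hF _ (List.mem_toFinset.2 (List.mem_map_of_mem h))
    · exact hΓ i h

lemma HasPrefixCover.mono {rules : List (Fact m) → Fact m → Prop} {x : List (Fin m)}
    {q : Fact m} {n B B' : ℕ} (h : HasPrefixCover rules x q n B) (hB : B ≤ B') :
    HasPrefixCover rules x q n B' := by
  obtain ⟨F, h1, h2, h3, h4⟩ := h
  exact ⟨F, h1, h2, h3.trans hB, h4⟩

lemma chainRule_cn_take {Γ : Set (Fact m)} {x : List (Fin m)} {n : ℕ} (hk : k ≤ n)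
    (hn : Cn (ChainRule m k) Γ (.derived n (x.take n)))
    (hx : ∀ i ∈ x.drop n, Cn (ChainRule m k) Γ (.base i)) {j : ℕ} (hj : n ≤ j)
    (hjx : j ≤ x.length) : Cn (ChainRule m k) Γ (.derived j (x.take j)) := by
  induction j, hj using Nat.le_induction with
  | base => exact hn
  | succ j hj ih =>
    have hlt : j < x.length := hjx
    rw [← List.take_concat_get' x j hlt]
    refine .step _ _ (.extend j _ _ (hk.trans hj) (by simp; omega)) ?_
    intro b hb
    rcases List.mem_cons.1 hb with rfl | hb
    · exact ih (by omega)
    · rw [List.mem_singleton] at hb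
      subst hb
      refine hx _ (List.mem_drop_iff_getElem.2 ⟨j - n, by omega, ?_⟩)
      congr 1
      omega

lemma chainRule_cn_of_base {Γ : Set (Fact m)} {x : List (Fin m)} (hk : k ≤ x.length)
    (hx : ∀ i ∈ x, Cn (ChainRule m k) Γ (.base i)) :
    Cn (ChainRule m k) Γ (.derived x.length x) := by
  have h := chainRule_cn_take (Γ := Γ) (x := x) le_rfl (.step _ _ (.init (x.take k) (by simpa)) ?_)
    (fun i hi => hx i (List.mem_of_mem_drop hi)) hk le_rfl
  · rwa [List.take_length] at h
  · intro b hb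
    obtain ⟨i, hi, rfl⟩ := List.mem_map.1 hb
    exact hx i (List.mem_of_mem_take hi)

/-- In the chain program one derived fact covers a long prefix. -/
lemma hasPrefixCover_chain (hk : 1 ≤ k) {x : List (Fin m)} (hx : k ≤ x.length) {n : ℕ}
    (hn : n ≤ x.length) :
    HasPrefixCover (ChainRule m k) x (.derived x.length x) n k := by
  rcases lt_or_ge n k with h | h
  · exact (hasPrefixCover_of_base fun Γ hΓ => chainRule_cn_of_base hx hΓ).mono h.le
  · refine ⟨{.derived n (x.take n)}, fun f hf => ?_, ?_, by simpa using hk, fun Γ hΓ hF => ?_⟩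
    · rw [mem_singleton] at hf
      subst hf
      have := chainRule_cn_of_base (k := k) (Γ := premiseBase m) (x := x.take n)
        (by simp; omega) fun i _ => cn_premiseBase _ i
      rwa [List.length_take, min_eq_left hn] at this
    · simp [Fact.arity]
    · have := chainRule_cn_take h (hF _ (mem_singleton_self _)) hΓ hn le_rfl
      rwa [List.take_length] at this

lemma mergeRule_cn_of_base {Γ : Set (Fact m)} {d : ℕ} {x : List (Fin m)}
    (hx : x.length = k * 2 ^ d) (hΓ : ∀ i ∈ x, Cn (MergeRule m k) Γ (.base i)) :
    Cn (MergeRule m k) Γ (.derived (d + 1) x) := by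
  induction d generalizing x with
  | zero =>
    refine .step _ _ (.init x (by simpa using hx)) fun b hb => ?_
    obtain ⟨i, hi, rfl⟩ := List.mem_map.1 hb
    exact hΓ i hi
  | succ d ih =>
    have h2 : k * 2 ^ (d + 1) = k * 2 ^ d + k * 2 ^ d := by ring
    have hy : (x.take (k * 2 ^ d)).length = k * 2 ^ d := by
      rw [List.length_take]
      omega
    have hz : (x.drop (k * 2 ^ d)).length = k * 2 ^ d := by
      rw [List.length_drop]
      omega
    rw [← List.take_append_drop (k * 2 ^ d) x]
    refine .step _ _ (.merge (d + 1) _ _ (by omega) (by simpa using hy) (by simpa using hz)) ?_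
    intro b hb
    rcases List.mem_cons.1 hb with rfl | hb
    · exact ih hy fun i hi => hΓ i (List.mem_of_mem_take hi)
    · rw [List.mem_singleton] at hb
      subst hb
      exact ih hz fun i hi => hΓ i (List.mem_of_mem_drop hi)

/-- In the merge program a prefix is covered by one derived fact per level of the derivation tree,
and base facts at the lowest level: a prefix that contains the left half is covered by the fact of
the left half and a cover in the right half, a shorter one by a cover in the left half. -/
lemma hasPrefixCover_merge {d : ℕ} {x : List (Fin m)} (hx : x.length = k * 2 ^ d) {n : ℕ}
    (hn : n ≤ x.length) :
    HasPrefixCover (MergeRule m k) x (.derived (d + 1) x) n (k + d) := by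
  classical
  induction d generalizing x n with
  | zero =>
    refine (hasPrefixCover_of_base fun Γ hΓ => mergeRule_cn_of_base hx hΓ).mono ?_
    simpa [hx] using hn
  | succ d ih =>
    have h2 : k * 2 ^ (d + 1) = k * 2 ^ d + k * 2 ^ d := by ring
    set h := k * 2 ^ d with hh
    have hy : (x.take h).length = h := by
      rw [List.length_take]
      omega
    have hz : (x.drop h).length = h := by
      rw [List.length_drop]
      omega
    have hmerge : ∀ Γ : Set (Fact m), Cn (MergeRule m k) Γ (.derived (d + 1) (x.take h)) →
        Cn (MergeRule m k) Γ (.derived (d + 1) (x.drop h)) →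
        Cn (MergeRule m k) Γ (.derived (d + 1 + 1) x) := by
      intro Γ h1 h2
      have : Cn (MergeRule m k) Γ (.derived (d + 1 + 1) (x.take h ++ x.drop h)) := by
        refine .step _ _ (.merge (d + 1) _ _ (by omega) (by rwa [Nat.add_sub_cancel])
          (by rwa [Nat.add_sub_cancel])) ?_
        intro b hb
        rcases List.mem_cons.1 hb with rfl | hb
        · exact h1
        · rw [List.mem_singleton] at hb
          subst hb
          exact h2
      rwa [List.take_append_drop] at this
    rcases lt_or_ge n h with hlt | hge
    · obtain ⟨F, h1, h2, h3, h4⟩ := ih hy (n := n) (by omega)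
      refine ⟨F, h1, h2, by omega, fun Γ hΓ hF => hmerge Γ ?_ ?_⟩
      · refine h4 Γ (fun i hi => hΓ i ?_) hF
        rw [List.drop_take] at hi
        exact List.mem_of_mem_take hi
      · refine mergeRule_cn_of_base hz fun i hi => hΓ i ?_
        have : x.drop h = (x.drop n).drop (h - n) := by
          rw [List.drop_drop]
          congr 1
          omega
        rw [this] at hi
        exact List.mem_of_mem_drop hi
    · obtain ⟨F, h1, h2, h3, h4⟩ := ih hz (n := n - h) (by omega)
      refine ⟨insert (.derived (d + 1) (x.take h)) F, fun f hf => ?_, ?_, ?_, fun Γ hΓ hF => ?_⟩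
      · rcases mem_insert.1 hf with rfl | hf
        · exact mergeRule_cn_of_base hy fun i _ => cn_premiseBase _ i
        · exact h1 f hf
      · have e : ∑ f ∈ insert (.derived (d + 1) (x.take h)) F, Fact.arity f
            ≤ h + ∑ f ∈ F, f.arity := by
          by_cases hmem : Fact.derived (d + 1) (x.take h) ∈ F
          · rw [insert_eq_of_mem hmem]
            omega
          · rw [sum_insert hmem, Fact.arity, hy]
        omega
      · have := card_insert_le (Fact.derived (d + 1) (x.take h)) F
        omega
      · refine hmerge Γ (hF _ (mem_insert_self _ _)) (h4 Γ (fun i hi => hΓ i ?_)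
          fun f hf => hF f (mem_insert_of_mem hf))
        rw [List.drop_drop] at hi
        convert hi using 2
        omega

lemma Architecture.two_le_arity (arch : Architecture) {d : ℕ} (hk : 2 ≤ k) (hd : 1 ≤ d) :
    2 ≤ arch.arity k d := by
  cases arch with
  | chain =>
    simp only [Architecture.arity]
    omega
  | merge =>
    exact hk.trans (Nat.le_mul_of_pos_right _ (by positivity))

/-- Every prefix of a depth-`d` query is covered by `O(log κ)` facts. -/
lemma Architecture.exists_hasPrefixCover (arch : Architecture) {d : ℕ} (hk : 2 ≤ k) (hd : 1 ≤ d) :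
    ∃ B : ℕ, (B : ℝ) ≤ (k + 1) * Real.logb 2 (arch.arity k d) ∧
      ∀ (m : ℕ) (x : Fin (arch.arity k d) → Fin m) (n : ℕ), n ≤ arch.arity k d →
        HasPrefixCover (arch.rules m k) (List.ofFn x) (arch.query k d x) n B := by
  have hlog := one_le_logb (arch.two_le_arity hk hd)
  have hk0 : (0 : ℝ) ≤ k := Nat.cast_nonneg k
  cases arch with
  | chain =>
    refine ⟨k, ?_, fun m x n hn => ?_⟩
    · have := mul_le_mul_of_nonneg_left hlog hk0
      linarith
    · have hlen : (List.ofFn x).length = k + d - 1 := List.length_ofFn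
      have := hasPrefixCover_chain (k := k) (by omega) (x := List.ofFn x) (n := n)
        (by rw [hlen]; omega) (by rwa [hlen])
      rw [hlen] at this
      exact this
  | merge =>
    refine ⟨k + (d - 1), ?_, fun m x n hn => ?_⟩
    · have h1 : ((d - 1 : ℕ) : ℝ) ≤ Real.logb 2 (Architecture.merge.arity k d) := by
        have : (2 : ℝ) ^ (d - 1) ≤ Architecture.merge.arity k d := by
          simp only [Architecture.arity]
          exact_mod_cast Nat.le_mul_of_pos_left _ (by omega)
        have h := Real.logb_le_logb_of_le one_lt_two (by positivity) this
        rwa [Real.logb_pow, Real.logb_self_eq_one one_lt_two, mul_one] at h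
      have := mul_le_mul_of_nonneg_left hlog hk0
      push_cast
      linarith
    · have hlen : (List.ofFn x).length = k * 2 ^ (d - 1) := List.length_ofFn
      have := hasPrefixCover_merge hlen (n := n) (by rwa [hlen])
      rw [Nat.sub_add_cancel hd] at this
      exact this

lemma storageBits_le (hm : 1 ≤ m) (F : Finset (Fact m)) :
    (storageBits F : ℝ) ≤ (∑ f ∈ F, f.arity : ℕ) * Real.logb 2 m + #F := by
  rw [storageBits]
  push_cast
  rw [sum_mul, show (#F : ℝ) = ∑ f ∈ F, 1 by simp, ← sum_add_distrib]
  refine sum_le_sum fun f _ => ?_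
  have := clog_le_logb_add_one (n := m ^ f.arity) (Nat.pow_pos hm)
  rwa [Nat.cast_pow, Real.logb_pow] at this

/-- Two-sided bounds on the minimum derivation-constrained cache: the first `κ - min N* κ`
coordinates are cached, the last `min N* κ` are left to survive. -/
lemma minDerivationCache_bounds {ε δ : ℝ} (hε₀ : 0 < ε) (hε₁ : ε < 1) (hδ₀ : 0 < δ) (hδ₁ : δ < 1)
    (arch : Architecture) {d : ℕ} (hk : 2 ≤ k) (hd : 1 ≤ d) (hκ : arch.arity k d ≤ m) :
    ((arch.arity k d : ℝ) - resilienceThreshold ε δ) * Real.logb 2 m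
        ≤ minDerivationCache arch k d m ε δ ∧
      (minDerivationCache arch k d m ε δ : ℝ)
        ≤ (arch.arity k d - min (resilienceThreshold ε δ) (arch.arity k d) : ℕ) * Real.logb 2 m
          + (k + 1) * Real.logb 2 (arch.arity k d) := by
  classical
  have hm : 1 ≤ m := by
    have := arch.two_le_arity hk hd
    omega
  have hL : 0 ≤ Real.logb 2 m := Real.logb_nonneg one_lt_two (by exact_mod_cast hm)
  obtain ⟨B, hB, hcov⟩ := arch.exists_hasPrefixCover hk hd
  set N := min (resilienceThreshold ε δ) (arch.arity k d) with hN
  set n := arch.arity k d - N with hn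
  choose F hF1 hF2 hF3 hF4 using fun x => hcov m x n (Nat.sub_le _ _)
  have hscheme : IsDerivationScheme arch k d m ε δ ⌊n * Real.logb 2 m + B⌋₊ F := by
    intro x _
    refine ⟨hF1 x, Nat.le_floor ?_, ?_⟩
    · refine (storageBits_le hm _).trans (add_le_add (mul_le_mul_of_nonneg_right ?_ hL) ?_)
      · exact_mod_cast hF2 x
      · exact_mod_cast hF3 x
    · set U := ((List.ofFn x).drop n).toFinset
      have hU : #U ≤ N := by
        refine (List.toFinset_card_le _).trans ?_
        rw [List.length_drop, List.length_ofFn]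
        omega
      have h1 := (le_resilienceThreshold_iff hε₀ hε₁ hδ₀ hδ₁ #U).1 (hU.trans (min_le_left _ _))
      rw [← erasureProb_disjoint] at h1
      refine h1.trans (erasureProb_mono hε₀ hε₁ fun E hE => hF4 x _ (fun i hi => ?_) fun f hf => ?_)
      · exact .premise _ (Or.inl ⟨i, hE i (List.mem_toFinset.2 hi), rfl⟩)
      · exact .premise _ (Or.inr hf)
  constructor
  · obtain ⟨S, hS⟩ : minDerivationCache arch k d m ε δ ∈
        {σ : ℕ | ∃ S, IsDerivationScheme arch k d m ε δ σ S} := Nat.sInf_mem ⟨_, F, hscheme⟩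
    exact le_of_isDerivationScheme hε₀ hε₁ hδ₀ hδ₁ hm hκ hS
  · have h1 : minDerivationCache arch k d m ε δ ≤ ⌊n * Real.logb 2 m + B⌋₊ :=
      Nat.sInf_le ⟨F, hscheme⟩
    have h2 : (minDerivationCache arch k d m ε δ : ℝ) ≤ n * Real.logb 2 m + B :=
      (Nat.cast_le.2 h1).trans (Nat.floor_le (by positivity))
    linarith

end

end Dispersion

namespace Dispersion

/-! ### The effective dispersion of derivation-constrained caching -/

section

variable {ε δ : ℝ}

lemma abs_minDerivationCache_sub_le (hε₀ : 0 < ε) (hε₁ : ε < 1) (hδ₀ : 0 < δ) (hδ₁ : δ < 1)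
    (arch : Architecture) {k m d : ℕ} (hk : 2 ≤ k) (hd : 1 ≤ d) (hκ : arch.arity k d ≤ m)
    (hN : resilienceThreshold ε δ ≤ arch.arity k d) :
    |(minDerivationCache arch k d m ε δ : ℝ)
        - ((arch.arity k d : ℝ) - resilienceThreshold ε δ) * Real.logb 2 m|
      ≤ (k + 1) * Real.logb 2 (arch.arity k d) := by
  obtain ⟨hl, hu⟩ := minDerivationCache_bounds hε₀ hε₁ hδ₀ hδ₁ arch hk hd hκ
  rw [min_eq_left hN, Nat.cast_sub hN] at hu
  rw [abs_of_nonneg (by linarith)]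
  linarith

lemma abs_minDerivationCache_sub_mul_logb_le (hε₀ : 0 < ε) (hε₁ : ε < 1) (hδ₀ : 0 < δ)
    (hδ₁ : δ < 1) (arch : Architecture) {k m d : ℕ} (hk : 2 ≤ k) (hd : 1 ≤ d)
    (hκ : arch.arity k d ≤ m) :
    |(minDerivationCache arch k d m ε δ : ℝ) - (arch.arity k d : ℝ) * Real.logb 2 m|
      ≤ (resilienceThreshold ε δ + k + 1) * Real.logb 2 m := by
  obtain ⟨hl, hu⟩ := minDerivationCache_bounds hε₀ hε₁ hδ₀ hδ₁ arch hk hd hκ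
  have h2 := arch.two_le_arity hk hd
  have hL := one_le_logb (h2.trans hκ)
  have hlog : Real.logb 2 (arch.arity k d) ≤ Real.logb 2 m :=
    Real.logb_le_logb_of_le one_lt_two (by exact_mod_cast (by omega : 0 < arch.arity k d))
      (by exact_mod_cast hκ)
  have h3 : ((arch.arity k d - min (resilienceThreshold ε δ) (arch.arity k d) : ℕ) : ℝ)
      ≤ arch.arity k d := by exact_mod_cast Nat.sub_le _ _
  have h4 := mul_le_mul_of_nonneg_right h3 (by linarith : 0 ≤ Real.logb 2 m)
  have h5 : ((k : ℝ) + 1) * Real.logb 2 (arch.arity k d) ≤ (k + 1) * Real.logb 2 m := by gcongr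
  have h6 : 0 ≤ (resilienceThreshold ε δ : ℝ) * Real.logb 2 m := by positivity
  have h7 : 0 ≤ ((k : ℝ) + 1) * Real.logb 2 m := by positivity
  rw [abs_le]
  constructor <;> linarith

lemma hasDispersion_minDerivationCache (hε₀ : 0 < ε) (hε₁ : ε < 1) (hδ₀ : 0 < δ) (hδ₁ : δ < 1)
    (arch : Architecture) {k : ℕ} (hk : 2 ≤ k) :
    HasDispersion δ {p | 1 ≤ p.2 ∧ arch.arity k p.2 ≤ p.1} (fun p => p.1)
      (fun p => arch.arity k p.2) (fun p => (minDerivationCache arch k p.2 p.1 ε δ : ℝ))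
      (fun m => Real.logb 2 m) (fun _ => 0) := by
  refine ⟨fun _ => le_rfl, resilienceThreshold ε δ + k + 1, fun p hp => ?_⟩
  simpa using abs_minDerivationCache_sub_mul_logb_le hε₀ hε₁ hδ₀ hδ₁ arch hk hp.1 hp.2

end

lemma Architecture.le_arity (arch : Architecture) {k : ℕ} (hk : 2 ≤ k) (n : ℕ) :
    n ≤ arch.arity k (n + 1) := by
  cases arch with
  | chain =>
    simp only [Architecture.arity]
    omega
  | merge =>
    simp only [Architecture.arity, Nat.add_sub_cancel]
    have := Nat.lt_two_pow_self (n := n)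
    nlinarith

end Dispersion

theorem mainTheorem8 (ε δ : ℝ) (hε₀ : 0 < ε) (hε₁ : ε < 1) (hδ₀ : 0 < δ) (hδ₁ : δ < 1) :
    -- (I) coded scheme, all queries in `[m]^κ`, `κ ≤ m`: dispersion `V_cache`
    (Dispersion.HasDispersion δ {p | 2 ≤ p.1 ∧ 1 ≤ p.2 ∧ p.2 ≤ p.1} (fun p => p.1) (fun p => p.2)
        (fun p => (Dispersion.minCodedCache
          (Set.univ : Set (Fin p.2 → Fin p.1)) ε δ : ℝ))
        (fun m => ε * Real.logb 2 m) (Dispersion.cacheDispersion ε)) ∧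
    (δ ≠ 1 / 2 → ∀ v : ℝ,
      Dispersion.HasDispersion δ {p | 2 ≤ p.1 ∧ 1 ≤ p.2 ∧ p.2 ≤ p.1} (fun p => p.1) (fun p => p.2)
        (fun p => (Dispersion.minCodedCache
          (Set.univ : Set (Fin p.2 → Fin p.1)) ε δ : ℝ))
        (fun m => ε * Real.logb 2 m) (fun m => v * Real.logb 2 m ^ 2) → v = ε * (1 - ε)) ∧
    -- (I) coded scheme, distinct-coordinate queries, `κ = O(√m)`: dispersion `V_cache`
    (∀ A : ℕ, Dispersion.HasDispersion δ
        {p | 2 ≤ p.1 ∧ 1 ≤ p.2 ∧ p.2 ≤ p.1 ∧ p.2 ^ 2 ≤ A * p.1} (fun p => p.1) (fun p => p.2)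
        (fun p => (Dispersion.minCodedCache (Dispersion.distinctTuples p.1 p.2) ε δ : ℝ))
        (fun m => ε * Real.logb 2 m) (Dispersion.cacheDispersion ε)) ∧
    (δ ≠ 1 / 2 → ∀ A : ℕ, 1 ≤ A → ∀ v : ℝ,
      Dispersion.HasDispersion δ
        {p | 2 ≤ p.1 ∧ 1 ≤ p.2 ∧ p.2 ≤ p.1 ∧ p.2 ^ 2 ≤ A * p.1} (fun p => p.1) (fun p => p.2)
        (fun p => (Dispersion.minCodedCache (Dispersion.distinctTuples p.1 p.2) ε δ : ℝ))
        (fun m => ε * Real.logb 2 m) (fun m => v * Real.logb 2 m ^ 2) → v = ε * (1 - ε)) ∧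
    -- (I) order of the coded second-order term
    (∃ C : ℝ, ∀ m κ : ℕ, 1 ≤ m →
      |√(κ * Dispersion.cacheDispersion ε m) * Dispersion.normalQuantile (1 - δ)|
        ≤ C * (√κ * Real.logb 2 m)) ∧
    (δ ≠ 1 / 2 → ∃ c : ℝ, 0 < c ∧ ∀ m κ : ℕ, 1 ≤ m →
      c * (√κ * Real.logb 2 m) ≤
        |√(κ * Dispersion.cacheDispersion ε m) * Dispersion.normalQuantile (1 - δ)|) ∧
    ∀ (arch : Dispersion.Architecture) (k : ℕ), 2 ≤ k →
      -- (II) derivation-constrained scheme: expansion and second-order term `O(log m)`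
      (∃ C : ℝ, ∀ m d : ℕ, 1 ≤ d → arch.arity k d ≤ m →
        Dispersion.resilienceThreshold ε δ ≤ arch.arity k d →
        |(Dispersion.minDerivationCache arch k d m ε δ : ℝ)
            - ((arch.arity k d : ℝ) - Dispersion.resilienceThreshold ε δ) * Real.logb 2 m|
          ≤ C * Real.logb 2 (arch.arity k d)) ∧
      (∃ C : ℝ, ∀ m d : ℕ, 1 ≤ d → arch.arity k d ≤ m →
        |(Dispersion.minDerivationCache arch k d m ε δ : ℝ)
            - (arch.arity k d : ℝ) * Real.logb 2 m| ≤ C * Real.logb 2 m) ∧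
      -- (III) the effective dispersion of the derivation-constrained scheme is `0`
      (Dispersion.HasDispersion δ {p | 1 ≤ p.2 ∧ arch.arity k p.2 ≤ p.1}
          (fun p => p.1) (fun p => arch.arity k p.2)
          (fun p => (Dispersion.minDerivationCache arch k p.2 p.1 ε δ : ℝ))
          (fun m => Real.logb 2 m) (fun _ => 0)) ∧
      (δ ≠ 1 / 2 → ∀ v : ℝ,
        Dispersion.HasDispersion δ {p | 1 ≤ p.2 ∧ arch.arity k p.2 ≤ p.1}
          (fun p => p.1) (fun p => arch.arity k p.2)
          (fun p => (Dispersion.minDerivationCache arch k p.2 p.1 ε δ : ℝ))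
          (fun m => Real.logb 2 m) (fun m => v * Real.logb 2 m ^ 2) → v = 0) := by
  have hv : 0 < ε * (1 - ε) := mul_pos hε₀ (by linarith)
  have hsq : ∀ m κ : ℕ, 1 ≤ m →
      |√(κ * Dispersion.cacheDispersion ε m) * Dispersion.normalQuantile (1 - δ)|
        = √(ε * (1 - ε)) * |Dispersion.normalQuantile (1 - δ)| * (√κ * Real.logb 2 m) := by
    intro m κ hm
    have hL : 0 ≤ Real.logb 2 m := Real.logb_nonneg one_lt_two (by exact_mod_cast hm)
    rw [Dispersion.cacheDispersion, Dispersion.sqrt_mul_mul_logb_sq _ _ _ hv.le, abs_mul,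
      abs_of_nonneg (by positivity), Real.sqrt_mul (Nat.cast_nonneg κ)]
    ring
  have huniv : Dispersion.HasDispersion δ {p | 2 ≤ p.1 ∧ 1 ≤ p.2 ∧ p.2 ≤ p.1} (fun p => p.1)
      (fun p => p.2)
      (fun p => (Dispersion.minCodedCache (Set.univ : Set (Fin p.2 → Fin p.1)) ε δ : ℝ))
      (fun m => ε * Real.logb 2 m) (Dispersion.cacheDispersion ε) :=
    Dispersion.hasDispersion_minCodedCache hε₀ hε₁ hδ₀ hδ₁ (fun p hp => hp)
      (fun p => (Set.univ : Set (Fin p.2 → Fin p.1))) 0 fun p _ => by simp [Set.ncard_univ]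
  have hdist : ∀ A : ℕ, Dispersion.HasDispersion δ
      {p | 2 ≤ p.1 ∧ 1 ≤ p.2 ∧ p.2 ≤ p.1 ∧ p.2 ^ 2 ≤ A * p.1} (fun p => p.1) (fun p => p.2)
      (fun p => (Dispersion.minCodedCache (Dispersion.distinctTuples p.1 p.2) ε δ : ℝ))
      (fun m => ε * Real.logb 2 m) (Dispersion.cacheDispersion ε) := fun A =>
    Dispersion.hasDispersion_minCodedCache hε₀ hε₁ hδ₀ hδ₁
      (fun p hp => ⟨hp.1, hp.2.1, hp.2.2.1⟩)
      (fun p => Dispersion.distinctTuples p.1 p.2) (4 * A)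
      fun p hp => Dispersion.pow_le_mul_ncard_distinctTuples hp.1 hp.2.2.1 hp.2.2.2
  refine ⟨huniv, fun hδ v h => ?_, hdist, fun hδ A hA v h => ?_, ?_, fun hδ => ?_,
    fun arch k hk => ⟨⟨k + 1, fun m d hd hκ hN =>
      Dispersion.abs_minDerivationCache_sub_le hε₀ hε₁ hδ₀ hδ₁ arch hk hd hκ hN⟩,
      ⟨Dispersion.resilienceThreshold ε δ + k + 1, fun m d hd hκ =>
        Dispersion.abs_minDerivationCache_sub_mul_logb_le hε₀ hε₁ hδ₀ hδ₁ arch hk hd hκ⟩,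
      Dispersion.hasDispersion_minDerivationCache hε₀ hε₁ hδ₀ hδ₁ arch hk, fun hδ v h => ?_⟩⟩
  · exact h.coeff_unique (Dispersion.normalQuantile_ne_zero hδ₀ hδ₁ hδ) huniv fun n =>
      ⟨(n + 2, n + 2), ⟨by simp, by simp, le_rfl⟩, by simp, by simp⟩
  · have hself : ∀ n : ℕ, n + 2 ≤ (n + 2) ^ 2 := fun n => Nat.le_self_pow two_ne_zero _
    exact h.coeff_unique (Dispersion.normalQuantile_ne_zero hδ₀ hδ₁ hδ) (hdist A) fun n =>
      ⟨((n + 2) ^ 2, n + 2), ⟨le_trans (by simp) (hself n), by simp, hself n,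
        Nat.le_mul_of_pos_left _ hA⟩, le_trans (by simp) (hself n), by simp⟩
  · exact ⟨_, fun m κ hm => (hsq m κ hm).le⟩
  · exact ⟨_, mul_pos (Real.sqrt_pos.2 hv)
      (abs_pos.2 (Dispersion.normalQuantile_ne_zero hδ₀ hδ₁ hδ)), fun m κ hm => (hsq m κ hm).ge⟩
  · have h0 : Dispersion.HasDispersion δ {p | 1 ≤ p.2 ∧ arch.arity k p.2 ≤ p.1}
        (fun p => p.1) (fun p => arch.arity k p.2)
        (fun p => (Dispersion.minDerivationCache arch k p.2 p.1 ε δ : ℝ))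
        (fun m => Real.logb 2 m) (fun m => 0 * Real.logb 2 m ^ 2) := by
      simpa only [zero_mul] using
        Dispersion.hasDispersion_minDerivationCache hε₀ hε₁ hδ₀ hδ₁ arch hk
    exact h.coeff_unique (Dispersion.normalQuantile_ne_zero hδ₀ hδ₁ hδ) h0 fun n =>
      ⟨(arch.arity k (n + 1), n + 1), ⟨by simp, le_rfl⟩, arch.two_le_arity hk (by omega),
        arch.le_arity hk n⟩
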